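/- Let $R=\bigoplus_{n\ge 0}R_n$ be a commutative standard graded ring: $R_0$ is Noetherian and $R$ is generated as an $R_0$-algebra by finitely many elements of $R_1$. Assume that $R_0$ is local with maximal ideal $\mathfrak m_0$, and put $R_+=\bigoplus_{n\ge 1}R_n$. For ideals $I,J$ of $R$ and an $R$-module $N$ let $\Gamma_{I,J}(N)=\{x\in N : I^nx\subseteq Jx \text{ for } n\gg 1\}$. For $I=R_+$ and $J=\mathfrak m_0R$ let $H^i_{I,J}$ denote the $i$-th right derived functor of $\Gamma_{I,J}$ on the category of $\mathbb Z$-graded $R$-modules and homogeneous maps of degree $0$; thus $H^i_{I,J}(N)$ is the $i$-th cohomology of $\Gamma_{I,J}(E^\bullet)$ for an injective resolution $E^\bullet$ of $N$ in that category, with graded components $H^i_{I,J}(N)_n$, $n\in\mathbb Z$. Suppose that one of the following two conditions holds: (a) for every finitely generated graded $R$-module $N$ and every $i\ge 0$, $H^i_{R_+,\mathfrak m_0R}(N)_n=0$ for all $n\gg 0$; (b) for every finitely generated graded $R$-module $N$, every $i\ge 0$ and every $n\in\mathbb Z$, $H^i_{R_+,\mathfrak m_0R}(N)_n$ is a finitely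 generated $R_0$-module. Let $M$ be a finitely generated graded $R$-module such that $c:=cd(R_+,\mathfrak m_0R,M)=\sup\{i : H^i_{R_+,\mathfrak m_0R}(M)\ne 0\}$ is a non-negative integer. Then $H^c_{R_+,\mathfrak m_0R}(M)$ is tame: either $H^c_{R_+,\mathfrak m_0R}(M)_n=0$ for all $n\ll 0$, or $H^c_{R_+,\mathfrak m_0R}(M)_n\neq 0$ for all $n\ll 0$. -/

import Mathlib

universe u

/-- The degree-zero subring `R₀` of an `ℕ`-graded ring `R = ⨁ Rₙ`. -/
abbrev baseRing {R : Type u} [CommRing R] (𝒜 : ℕ → AddSubgroup R) [GradedRing 𝒜] : Subring R :=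
  SetLike.GradeZero.subring 𝒜

/-- `R` is standard graded (over a Noetherian base): `R₀` is Noetherian and `R` is generated, as an
`R₀`-algebra, by finitely many elements of `R₁`. -/
def IsStandardGraded {R : Type u} [CommRing R] (𝒜 : ℕ → AddSubgroup R) [GradedRing 𝒜] : Prop :=
  IsNoetherianRing (baseRing 𝒜) ∧
    ∃ s : Finset R, (s : Set R) ⊆ 𝒜 1 ∧ Algebra.adjoin (baseRing 𝒜) (s : Set R) = ⊤

/-- The irrelevant ideal `R₊ = ⨁_{n > 0} Rₙ`. -/
def irrelevantIdeal {R : Type u} [CommRing R] (𝒜 : ℕ → AddSubgroup R) [GradedRing 𝒜] : Ideal R :=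
  (HomogeneousIdeal.irrelevant 𝒜).toIdeal

/-- The ideal `𝔪₀R` of `R` generated by the maximal ideal `𝔪₀` of the local ring `R₀`. -/
noncomputable def maxIdealExt {R : Type u} [CommRing R] (𝒜 : ℕ → AddSubgroup R) [GradedRing 𝒜]
    [IsLocalRing (baseRing 𝒜)] : Ideal R :=
  Ideal.map (baseRing 𝒜).subtype (IsLocalRing.maximalIdeal (baseRing 𝒜))

/-- A `ℤ`-graded `R`-module `M = ⨁_{n ∈ ℤ} Mₙ` over an `ℕ`-graded ring `R`. -/
structure GrModule {R : Type u} [CommRing R] (𝒜 : ℕ → AddSubgroup R) : Type (u + 1) where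
  carrier : Type u
  [grp : AddCommGroup carrier]
  [mod : Module R carrier]
  piece : ℤ → AddSubgroup carrier
  isInternal : DirectSum.IsInternal piece
  smul_mem' : ∀ (i : ℕ) (n : ℤ) (r : R) (x : carrier),
    r ∈ 𝒜 i → x ∈ piece n → r • x ∈ piece ((i : ℤ) + n)

namespace GrModule

instance {R : Type u} [CommRing R] (𝒜 : ℕ → AddSubgroup R) :
    CoeSort (GrModule 𝒜) (Type u) := ⟨GrModule.carrier⟩

instance {R : Type u} [CommRing R] {𝒜 : ℕ → AddSubgroup R} (M : GrModule 𝒜) :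
    AddCommGroup M := M.grp

instance {R : Type u} [CommRing R] {𝒜 : ℕ → AddSubgroup R} (M : GrModule 𝒜) :
    Module R M := M.mod

section

variable {R : Type u} [CommRing R] {𝒜 : ℕ → AddSubgroup R}

/-- An `R`-linear map of graded modules is homogeneous (of degree `0`), i.e. a morphism of the
category of graded `R`-modules. -/
def IsHomogeneousMap {M N : GrModule 𝒜} (f : M →ₗ[R] N) : Prop :=
  ∀ (n : ℤ) (x : M), x ∈ M.piece n → f x ∈ N.piece n

/-- Injective objects of the category of graded `R`-modules and homogeneous maps. -/
def IsStarInjective (E : GrModule 𝒜) : Prop :=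
  ∀ (X Y : GrModule 𝒜) (j : X →ₗ[R] Y) (f : X →ₗ[R] E), IsHomogeneousMap j →
    IsHomogeneousMap f → Function.Injective j →
      ∃ g : Y →ₗ[R] E, IsHomogeneousMap g ∧ g ∘ₗ j = f

/-- An injective resolution `0 → M → E⁰ → E¹ → ⋯` of `M` in the category of graded `R`-modules. -/
structure StarInjectiveResolution (M : GrModule 𝒜) where
  E : ℕ → GrModule 𝒜
  ι : M →ₗ[R] E 0
  d : ∀ i, E i →ₗ[R] E (i + 1)
  injective : ∀ i, IsStarInjective (E i)
  ι_homogeneous : IsHomogeneousMap ι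
  d_homogeneous : ∀ i, IsHomogeneousMap (d i)
  ι_injective : Function.Injective ι
  exact_zero : Function.Exact ι (d 0)
  exact_succ : ∀ i, Function.Exact (d i) (d (i + 1))

/-! ### Enough injectives in the category of graded modules -/

/-- A family of additive subgroups with compatible projections that spans is an internal direct
sum decomposition. -/
theorem isInternal_of_proj {A : Type u} [AddCommGroup A] (P : ℤ → AddSubgroup A)
    (π : ℤ → A →+ A) (h1 : ∀ n x, x ∈ P n → π n x = x)
    (h2 : ∀ m n x, x ∈ P n → m ≠ n → π m x = 0)
    (h3 : ∀ x, x ∈ ⨆ n, P n) : DirectSum.IsInternal P := by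
  classical
  constructor
  · rw [injective_iff_map_eq_zero]
    intro a ha
    have key : ∀ (m : ℤ) (b : DirectSum ℤ fun n => P n),
        π m (DirectSum.coeAddMonoidHom P b) = (b m : A) := by
      intro m b
      induction b using DirectSum.induction_on with
      | zero => simp
      | of n x =>
        rw [DirectSum.coeAddMonoidHom_of]
        by_cases hmn : m = n
        · subst hmn
          rw [DirectSum.of_eq_same]
          exact h1 _ _ x.2
        · rw [DirectSum.of_eq_of_ne _ _ _ hmn]
          exact h2 _ _ _ x.2 hmn
      | add b c hb hc => simp [hb, hc]
    ext m
    rw [← key m a, ha]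
    simp
  · intro x
    have hle : (⨆ n, P n) ≤ (DirectSum.coeAddMonoidHom P).range := by
      refine iSup_le fun n x hx => ⟨DirectSum.of (fun n => P n) n ⟨x, hx⟩, ?_⟩
      simp
    exact hle (h3 x)

/-- Projection of a graded module onto its degree-`n` part. -/
noncomputable def proj (M : GrModule 𝒜) (n : ℤ) : M →+ M :=
  ((M.piece n).subtype.comp (DFinsupp.evalAddMonoidHom n)).comp
    (AddEquiv.ofBijective (DirectSum.coeAddMonoidHom M.piece) M.isInternal).symm.toAddMonoidHom

theorem proj_coe (M : GrModule 𝒜) (n : ℤ) (b : DirectSum ℤ fun n => M.piece n) :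
    M.proj n (DirectSum.coeAddMonoidHom M.piece b) = b n := by
  have : (AddEquiv.ofBijective (DirectSum.coeAddMonoidHom M.piece) M.isInternal).symm
      (DirectSum.coeAddMonoidHom M.piece b) = b :=
    (AddEquiv.ofBijective (DirectSum.coeAddMonoidHom M.piece) M.isInternal).symm_apply_apply b
  simp only [proj, AddMonoidHom.comp_apply]
  erw [this]
  rfl

theorem proj_same (M : GrModule 𝒜) (n : ℤ) (x : M) (hx : x ∈ M.piece n) : M.proj n x = x := by
  have := M.proj_coe n (DirectSum.of (fun n => M.piece n) n ⟨x, hx⟩)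
  rwa [DirectSum.coeAddMonoidHom_of, DirectSum.of_eq_same] at this

theorem proj_ne (M : GrModule 𝒜) (m n : ℤ) (x : M) (hx : x ∈ M.piece n) (h : m ≠ n) :
    M.proj m x = 0 := by
  have := M.proj_coe m (DirectSum.of (fun n => M.piece n) n ⟨x, hx⟩)
  rwa [DirectSum.coeAddMonoidHom_of, DirectSum.of_eq_of_ne _ _ _ h] at this

theorem mem_iSup_piece (M : GrModule 𝒜) (x : M) : x ∈ ⨆ n, M.piece n := by
  obtain ⟨b, rfl⟩ := M.isInternal.2 x
  induction b using DirectSum.induction_on with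
  | zero => simp
  | of n x =>
    rw [DirectSum.coeAddMonoidHom_of]
    exact AddSubgroup.mem_iSup_of_mem n x.2
  | add b c hb hc =>
    rw [map_add]
    exact add_mem hb hc

/-- To prove an additive statement about elements of a graded module it suffices to treat
homogeneous elements. -/
theorem induction_piece (M : GrModule 𝒜) {p : M → Prop} (h0 : p 0)
    (hadd : ∀ x y, p x → p y → p (x + y)) (h : ∀ n x, x ∈ M.piece n → p x) (x : M) : p x := by
  obtain ⟨b, rfl⟩ := M.isInternal.2 x
  induction b using DirectSum.induction_on with
  | zero => simpa using h0
  | of n x =>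
    rw [DirectSum.coeAddMonoidHom_of]
    exact h n _ x.2
  | add b c hb hc =>
    rw [map_add]
    exact hadd _ _ hb hc

theorem IsHomogeneousMap.map_proj {M N : GrModule 𝒜} {f : M →ₗ[R] N} (hf : IsHomogeneousMap f)
    (n : ℤ) (x : M) : f (M.proj n x) = N.proj n (f x) := by
  induction x using M.induction_piece with
  | h0 => simp
  | hadd x y hx hy => simp [hx, hy]
  | h m x hx =>
    by_cases hmn : n = m
    · subst hmn
      rw [M.proj_same _ _ hx, N.proj_same _ _ (hf _ _ hx)]
    · rw [M.proj_ne _ _ _ hx hmn, N.proj_ne _ _ _ (hf _ _ hx) hmn, map_zero]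

/-- The graded cokernel of a homogeneous map. -/
noncomputable def coker {M N : GrModule 𝒜} (f : M →ₗ[R] N) (hf : IsHomogeneousMap f) :
    GrModule 𝒜 where
  carrier := N ⧸ LinearMap.range f
  piece n := (N.piece n).map (LinearMap.range f).mkQ.toAddMonoidHom
  isInternal := by
    refine isInternal_of_proj _ (fun n => QuotientAddGroup.map
      (LinearMap.range f).toAddSubgroup (LinearMap.range f).toAddSubgroup (N.proj n) ?_) ?_ ?_ ?_
    · rintro _ ⟨x, rfl⟩
      exact ⟨M.proj n x, hf.map_proj n x⟩
    · rintro n _ ⟨x, hx, rfl⟩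
      exact congrArg (LinearMap.range f).mkQ (N.proj_same n x hx)
    · rintro m n _ ⟨x, hx, rfl⟩ h
      exact congrArg (LinearMap.range f).mkQ (N.proj_ne m n x hx h)
    · intro y
      obtain ⟨x, rfl⟩ := (LinearMap.range f).mkQ_surjective y
      induction x using N.induction_piece with
      | h0 => simp
      | hadd x y hx hy =>
        rw [map_add]
        exact add_mem hx hy
      | h n x hx => exact AddSubgroup.mem_iSup_of_mem n ⟨x, hx, rfl⟩
  smul_mem' := by
    rintro i n r _ hr ⟨x, hx, rfl⟩
    exact ⟨r • x, N.smul_mem' i n r x hr hx, map_smul (LinearMap.range f).mkQ r x⟩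

/-- The additive group of `C[T, T⁻¹] = ⨁_{n ∈ ℤ} C Tⁿ`. -/
def Laurent (C : Type u) [AddCommGroup C] : Type u := ℤ →₀ C

noncomputable instance (C : Type u) [AddCommGroup C] : AddCommGroup (Laurent C) :=
  inferInstanceAs (AddCommGroup (ℤ →₀ C))

/-- The monomial `c Tⁿ`. -/
noncomputable def Laurent.mono {C : Type u} [AddCommGroup C] (n : ℤ) : C →+ Laurent C :=
  Finsupp.singleAddHom n

/-- The coefficient of `Tⁿ`. -/
noncomputable def Laurent.coeff {C : Type u} [AddCommGroup C] (n : ℤ) : Laurent C →+ C :=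
  Finsupp.applyAddHom n

theorem Laurent.induction {C : Type u} [AddCommGroup C] {p : Laurent C → Prop} (h0 : p 0)
    (hadd : ∀ x y, p x → p y → p (x + y)) (h : ∀ n c, p (Laurent.mono n c)) (x : Laurent C) :
    p x :=
  Finsupp.induction_linear (motive := p) x h0 hadd h

theorem Laurent.coeff_mono_same {C : Type u} [AddCommGroup C] (n : ℤ) (c : C) :
    Laurent.coeff n (Laurent.mono n c) = c :=
  Finsupp.single_eq_same

theorem Laurent.coeff_mono_ne {C : Type u} [AddCommGroup C] {m n : ℤ} (h : m ≠ n) (c : C) :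
    Laurent.coeff m (Laurent.mono n c) = 0 :=
  Finsupp.single_eq_of_ne h

/-- Lift an additive map out of each `C Tⁿ` to `C[T, T⁻¹]`. -/
noncomputable def Laurent.lift {C A : Type u} [AddCommGroup C] [AddCommGroup A]
    (f : ℤ → C →+ A) : Laurent C →+ A :=
  Finsupp.liftAddHom f

theorem Laurent.lift_mono {C A : Type u} [AddCommGroup C] [AddCommGroup A]
    (f : ℤ → C →+ A) (n : ℤ) (c : C) : Laurent.lift f (Laurent.mono n c) = f n c :=
  Finsupp.liftAddHom_apply_single f n c

theorem Laurent.hom_ext {C A : Type u} [AddCommGroup C] [AddCommGroup A]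
    {f g : Laurent C →+ A} (h : ∀ n c, f (Laurent.mono n c) = g (Laurent.mono n c)) : f = g := by
  ext x
  induction x using Laurent.induction with
  | h0 => simp
  | hadd x y hx hy => simp [hx, hy]
  | h n c => exact h n c

theorem Laurent.end_ext {C : Type u} [AddCommGroup C] {f g : AddMonoid.End (Laurent C)}
    (h : ∀ n c, f (Laurent.mono n c) = g (Laurent.mono n c)) : f = g :=
  Laurent.hom_ext (f := f) (g := g) h

/-- The action of a homogeneous `r ∈ Rᵢ` on `C[T, T⁻¹]`, namely `c Tⁿ ↦ (r c) Tⁱ⁺ⁿ`. -/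
noncomputable def Laurent.act (C : Type u) [AddCommGroup C] [Module R C] (i : ℕ) :
    𝒜 i →+ AddMonoid.End (Laurent C) where
  toFun r := Laurent.lift fun n =>
    (Laurent.mono ((i : ℤ) + n)).comp (DistribSMul.toAddMonoidHom C (r : R))
  map_zero' := Laurent.end_ext fun n c =>
    (Laurent.lift_mono _ _ _).trans (by simp)
  map_add' r s := Laurent.end_ext fun n c =>
    (Laurent.lift_mono _ _ _).trans (by
      refine Eq.trans ?_ (AddMonoidHom.add_apply _ _ _).symm
      rw [Laurent.lift_mono, Laurent.lift_mono]
      simp [add_smul])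

theorem Laurent.act_mono (C : Type u) [AddCommGroup C] [Module R C] (i : ℕ) (r : 𝒜 i) (n : ℤ)
    (c : C) : Laurent.act C i r (Laurent.mono n c) = Laurent.mono ((i : ℤ) + n) ((r : R) • c) :=
  Laurent.lift_mono _ _ _

/-- The ring homomorphism giving the graded action of `R` on `C[T, T⁻¹]`. -/
noncomputable def Laurent.actHom [GradedRing 𝒜] (C : Type u) [AddCommGroup C] [Module R C] :
    R →+* AddMonoid.End (Laurent C) :=
  (DirectSum.toSemiring (A := fun i => 𝒜 i) (fun i => Laurent.act C i)
    (Laurent.end_ext fun n c => by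
      rw [Laurent.act_mono]
      simp)
    (fun {i j} r s => Laurent.end_ext fun n c => by
      rw [Laurent.act_mono]
      refine Eq.trans ?_ (congrArg (Laurent.act C i r) (Laurent.act_mono C j s n c)).symm
      rw [Laurent.act_mono]
      simp [mul_smul, add_assoc, GradedMonoid.GMul.mul])).comp
    (DirectSum.decomposeRingEquiv 𝒜).toRingHom

theorem Laurent.actHom_mono [GradedRing 𝒜] (C : Type u) [AddCommGroup C] [Module R C] (i : ℕ)
    (r : R) (hr : r ∈ 𝒜 i) (n : ℤ) (c : C) :
    Laurent.actHom (𝒜 := 𝒜) C r (Laurent.mono n c) = Laurent.mono ((i : ℤ) + n) (r • c) := by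
  have h1 : DirectSum.decomposeRingEquiv 𝒜 r = DirectSum.of (fun i => 𝒜 i) i ⟨r, hr⟩ :=
    DirectSum.decompose_of_mem 𝒜 hr
  have h2 : Laurent.actHom (𝒜 := 𝒜) C r = Laurent.act C i (⟨r, hr⟩ : 𝒜 i) := by
    rw [Laurent.actHom, RingHom.comp_apply]
    refine (congrArg _ h1).trans ?_
    exact DirectSum.toSemiring_of _ _ _ _ _
  rw [h2, Laurent.act_mono]

/-- The graded `R`-module `C[T, T⁻¹]` attached to an `R`-module `C`: a homogeneous `r ∈ Rᵢ` acts by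
`r • c Tⁿ = (r c) Tⁱ⁺ⁿ`. This is the right adjoint of forgetting the grading. -/
noncomputable def cofree [GradedRing 𝒜] (C : Type u) [AddCommGroup C] [Module R C] :
    GrModule 𝒜 where
  carrier := Laurent C
  mod := Module.compHom (Laurent C) (Laurent.actHom (𝒜 := 𝒜) C)
  piece n := (Laurent.mono n).range
  isInternal := by
    refine isInternal_of_proj _ (fun n => (Laurent.mono n).comp (Laurent.coeff n)) ?_ ?_ ?_
    · rintro n _ ⟨c, rfl⟩
      simp [Laurent.coeff_mono_same]
    · rintro m n _ ⟨c, rfl⟩ h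
      simp [Laurent.coeff_mono_ne h]
    · intro x
      induction x using Laurent.induction with
      | h0 => simp
      | hadd x y hx hy => exact add_mem hx hy
      | h n c => exact AddSubgroup.mem_iSup_of_mem n ⟨c, rfl⟩
  smul_mem' := by
    rintro i n r _ hr ⟨c, rfl⟩
    exact ⟨r • c, (Laurent.actHom_mono C i r hr n c).symm⟩

/-- The monomial `c Tⁿ` as an element of the graded module `C[T, T⁻¹]`. -/
noncomputable def cofreeMono [GradedRing 𝒜] {C : Type u} [AddCommGroup C] [Module R C] (n : ℤ) :
    C →+ cofree (𝒜 := 𝒜) C :=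
  Laurent.mono n

theorem cofree_smul_mono [GradedRing 𝒜] (C : Type u) [AddCommGroup C] [Module R C] (i : ℕ)
    (r : R) (hr : r ∈ 𝒜 i) (n : ℤ) (c : C) :
    r • cofreeMono (𝒜 := 𝒜) n c = cofreeMono ((i : ℤ) + n) (r • c) :=
  Laurent.actHom_mono C i r hr n c

theorem cofree_induction [GradedRing 𝒜] {C : Type u} [AddCommGroup C] [Module R C]
    {p : cofree (𝒜 := 𝒜) C → Prop} (h0 : p 0) (hadd : ∀ x y, p x → p y → p (x + y))
    (h : ∀ n c, p (cofreeMono n c)) (x : cofree (𝒜 := 𝒜) C) : p x :=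
  Laurent.induction (p := p) h0 hadd h x

/-- An additive map commuting with homogeneous scalars is linear. -/
theorem map_smul_of_homogeneous [GradedRing 𝒜] {A B : Type u} [AddCommGroup A] [Module R A]
    [AddCommGroup B] [Module R B] (f : A →+ B)
    (h : ∀ (i : ℕ) (r : R), r ∈ 𝒜 i → ∀ x, f (r • x) = r • f x) (r : R) (x : A) :
    f (r • x) = r • f x := by
  induction r using DirectSum.Decomposition.inductionOn 𝒜 with
  | zero => simp
  | homogeneous r => exact h _ _ r.2 x
  | add r s hr hs => rw [add_smul, map_add, hr, hs, add_smul]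

/-- The additive map underlying `cofreeSum`. -/
noncomputable def cofreeSumAux [GradedRing 𝒜] (C : Type u) [AddCommGroup C] [Module R C] :
    cofree (𝒜 := 𝒜) C →+ C :=
  Laurent.lift fun _ => AddMonoidHom.id C

theorem cofreeSumAux_mono [GradedRing 𝒜] (C : Type u) [AddCommGroup C] [Module R C] (n : ℤ)
    (c : C) : cofreeSumAux (𝒜 := 𝒜) C (cofreeMono n c) = c :=
  Laurent.lift_mono _ n c

/-- The counit `C[T, T⁻¹] → C`, `∑ cₙ Tⁿ ↦ ∑ cₙ`. -/
noncomputable def cofreeSum [GradedRing 𝒜] (C : Type u) [AddCommGroup C] [Module R C] :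
    cofree (𝒜 := 𝒜) C →ₗ[R] C :=
  { cofreeSumAux C with
    map_smul' := map_smul_of_homogeneous (𝒜 := 𝒜) (cofreeSumAux C) (by
      intro i r hr x
      induction x using cofree_induction with
      | h0 => rw [smul_zero, map_zero, smul_zero]
      | hadd x y hx hy => rw [smul_add, map_add, map_add, smul_add, hx, hy]
      | h n c => rw [cofree_smul_mono C i r hr n c, cofreeSumAux_mono, cofreeSumAux_mono]) }

theorem cofreeSum_mono [GradedRing 𝒜] (C : Type u) [AddCommGroup C] [Module R C] (n : ℤ) (c : C) :
    cofreeSum (𝒜 := 𝒜) C (cofreeMono n c) = c :=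
  cofreeSumAux_mono C n c

/-- The additive map underlying `toCofree`. -/
noncomputable def toCofreeAux [GradedRing 𝒜] {C : Type u} [AddCommGroup C] [Module R C]
    (M : GrModule 𝒜) (h : M →ₗ[R] C) : M →+ cofree (𝒜 := 𝒜) C :=
  (DirectSum.toAddMonoid (β := fun n => M.piece n) (γ := Laurent C) fun n =>
    (Laurent.mono n).comp (h.toAddMonoidHom.comp (M.piece n).subtype)).comp
    (AddEquiv.ofBijective (DirectSum.coeAddMonoidHom M.piece) M.isInternal).symm.toAddMonoidHom

theorem toCofreeAux_of_mem [GradedRing 𝒜] {C : Type u} [AddCommGroup C] [Module R C]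
    (M : GrModule 𝒜) (h : M →ₗ[R] C) (n : ℤ) (x : M) (hx : x ∈ M.piece n) :
    toCofreeAux M h x = cofreeMono n (h x) := by
  have h1 : (AddEquiv.ofBijective (DirectSum.coeAddMonoidHom M.piece) M.isInternal).symm x =
      DirectSum.of (fun n => M.piece n) n ⟨x, hx⟩ := by
    rw [AddEquiv.symm_apply_eq]
    exact (DirectSum.coeAddMonoidHom_of M.piece n ⟨x, hx⟩).symm
  refine (congrArg (DirectSum.toAddMonoid (β := fun n => M.piece n) (γ := Laurent C) fun n =>
    (Laurent.mono n).comp (h.toAddMonoidHom.comp (M.piece n).subtype)) h1).trans ?_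
  exact DirectSum.toAddMonoid_of _ n _

/-- The homogeneous map `M → C[T, T⁻¹]` corresponding to a linear map `h : M → C`; it sends
`x ∈ Mₙ` to `h(x) Tⁿ`. -/
noncomputable def toCofree [GradedRing 𝒜] {C : Type u} [AddCommGroup C] [Module R C]
    (M : GrModule 𝒜) (h : M →ₗ[R] C) : M →ₗ[R] cofree (𝒜 := 𝒜) C :=
  { toCofreeAux M h with
    map_smul' := map_smul_of_homogeneous (𝒜 := 𝒜) (toCofreeAux M h) (by
      intro i r hr x
      induction x using M.induction_piece with
      | h0 => rw [smul_zero, map_zero, smul_zero]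
      | hadd x y hx hy => rw [smul_add, map_add, map_add, smul_add, hx, hy]
      | h n x hx =>
        rw [toCofreeAux_of_mem M h _ _ (M.smul_mem' i n r x hr hx),
          toCofreeAux_of_mem M h _ _ hx, map_smul]
        exact (cofree_smul_mono C i r hr n (h x)).symm) }

theorem toCofree_of_mem [GradedRing 𝒜] {C : Type u} [AddCommGroup C] [Module R C]
    (M : GrModule 𝒜) (h : M →ₗ[R] C) (n : ℤ) (x : M) (hx : x ∈ M.piece n) :
    toCofree M h x = cofreeMono n (h x) :=
  toCofreeAux_of_mem M h n x hx

theorem toCofree_homogeneous [GradedRing 𝒜] {C : Type u} [AddCommGroup C] [Module R C]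
    (M : GrModule 𝒜) (h : M →ₗ[R] C) : IsHomogeneousMap (toCofree M h) :=
  fun n x hx => ⟨h x, (toCofree_of_mem M h n x hx).symm⟩

theorem cofreeSum_toCofree [GradedRing 𝒜] {C : Type u} [AddCommGroup C] [Module R C]
    (M : GrModule 𝒜) (h : M →ₗ[R] C) (x : M) : cofreeSum C (toCofree M h x) = h x := by
  induction x using M.induction_piece with
  | h0 => simp
  | hadd x y hx hy => simp [hx, hy]
  | h n x hx =>
    rw [toCofree_of_mem M h n x hx]
    exact cofreeSum_mono C n _

theorem cofree_isStarInjective [GradedRing 𝒜] (C : Type u) [AddCommGroup C] [Module R C]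
    (hC : Module.Injective R C) : IsStarInjective (cofree (𝒜 := 𝒜) C) := by
  intro X Y j f hj hf hinj
  obtain ⟨h, hh⟩ := hC.out j hinj (cofreeSum C ∘ₗ f)
  refine ⟨toCofree Y h, toCofree_homogeneous Y h, ?_⟩
  ext x
  induction x using X.induction_piece with
  | h0 => simp
  | hadd x y hx hy => rw [map_add, map_add, hx, hy]
  | h n x hx =>
    obtain ⟨c, hc⟩ := hf n x hx
    have hfx : f x = cofreeMono n c := hc.symm
    rw [LinearMap.comp_apply, toCofree_of_mem Y h n _ (hj n x hx), hh, LinearMap.comp_apply, hfx,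
      cofreeSum_mono]

/-- An injective `R`-module containing `M`. -/
noncomputable def ungradedHull (M : GrModule 𝒜) : ModuleCat.{u} R :=
  CategoryTheory.Injective.under (ModuleCat.of R M)

/-- The embedding of `M` in an injective `R`-module. -/
noncomputable def toUngradedHull (M : GrModule 𝒜) : M →ₗ[R] M.ungradedHull :=
  (CategoryTheory.Injective.ι (ModuleCat.of R M)).hom

/-- A graded module that is injective in the category of graded modules and contains `M`. -/
noncomputable def hull [GradedRing 𝒜] (M : GrModule 𝒜) : GrModule 𝒜 :=
  cofree (𝒜 := 𝒜) M.ungradedHull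

theorem hull_isStarInjective [GradedRing 𝒜] (M : GrModule 𝒜) : IsStarInjective M.hull :=
  cofree_isStarInjective _ (Module.injective_module_of_injective_object
    (inj := inferInstanceAs (CategoryTheory.Injective
      (CategoryTheory.Injective.under (ModuleCat.of R M)))))

/-- The embedding of `M` in its hull. -/
noncomputable def toHull [GradedRing 𝒜] (M : GrModule 𝒜) : M →ₗ[R] M.hull :=
  toCofree M M.toUngradedHull

theorem toHull_homogeneous [GradedRing 𝒜] (M : GrModule 𝒜) : IsHomogeneousMap M.toHull :=
  toCofree_homogeneous _ _

theorem toHull_injective [GradedRing 𝒜] (M : GrModule 𝒜) : Function.Injective M.toHull := by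
  have h : Function.Injective M.toUngradedHull :=
    (ModuleCat.mono_iff_injective _).1 inferInstance
  intro x y hxy
  apply h
  have hxy' : toCofree M M.toUngradedHull x = toCofree M M.toUngradedHull y := hxy
  rw [← cofreeSum_toCofree M M.toUngradedHull x, hxy', cofreeSum_toCofree]

/-- The cosyzygies of `M`: `M⁰ = M` and `Mⁱ⁺¹` is the cokernel of `Mⁱ` in its hull. -/
noncomputable def cosyzygy [GradedRing 𝒜] (M : GrModule 𝒜) : ℕ → GrModule 𝒜
  | 0 => M
  | i + 1 => coker (cosyzygy M i).toHull (cosyzygy M i).toHull_homogeneous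

/-- The projection of the hull of a cosyzygy onto the next cosyzygy. -/
noncomputable def cosyzygyProj [GradedRing 𝒜] (M : GrModule 𝒜) (i : ℕ) :
    (M.cosyzygy i).hull →ₗ[R] M.cosyzygy (i + 1) :=
  (LinearMap.range (M.cosyzygy i).toHull).mkQ

theorem cosyzygyProj_surjective [GradedRing 𝒜] (M : GrModule 𝒜) (i : ℕ) :
    Function.Surjective (M.cosyzygyProj i) :=
  Submodule.mkQ_surjective _

theorem cosyzygyProj_eq_zero [GradedRing 𝒜] (M : GrModule 𝒜) (i : ℕ) (x : (M.cosyzygy i).hull) :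
    M.cosyzygyProj i x = 0 ↔ x ∈ Set.range (M.cosyzygy i).toHull :=
  (Submodule.Quotient.mk_eq_zero (LinearMap.range (M.cosyzygy i).toHull)).trans
    LinearMap.mem_range

/-- The injective resolution of a graded module obtained by iterating the embedding in the hull. -/
noncomputable def injRes [GradedRing 𝒜] (M : GrModule 𝒜) : StarInjectiveResolution M where
  E i := (M.cosyzygy i).hull
  ι := M.toHull
  d i := (M.cosyzygy (i + 1)).toHull ∘ₗ M.cosyzygyProj i
  injective i := hull_isStarInjective _
  ι_homogeneous := M.toHull_homogeneous
  d_homogeneous i n x hx := toHull_homogeneous _ n _ ⟨x, hx, rfl⟩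
  ι_injective := M.toHull_injective
  exact_zero x := by
    rw [LinearMap.comp_apply, map_eq_zero_iff _ (toHull_injective _)]
    exact M.cosyzygyProj_eq_zero 0 x
  exact_succ i x := by
    rw [LinearMap.comp_apply, map_eq_zero_iff _ (toHull_injective _), cosyzygyProj_eq_zero]
    constructor
    · rintro ⟨y, rfl⟩
      obtain ⟨z, rfl⟩ := M.cosyzygyProj_surjective i y
      exact ⟨z, rfl⟩
    · rintro ⟨z, rfl⟩
      exact ⟨M.cosyzygyProj i z, rfl⟩

end

end GrModule

/-! ### Local cohomology with respect to a pair of ideals -/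

/-- The `(I, J)`-torsion submodule `Γ_{I,J}(M) = {x ∈ M : Iⁿx ⊆ Jx for n ≫ 1}`. -/
def pairTorsion {R : Type u} [CommRing R] (I J : Ideal R) (M : Type u) [AddCommGroup M]
    [Module R M] : Submodule R M where
  carrier := {x | ∃ k : ℕ, ∀ n ≥ k, I ^ n • Submodule.span R {x} ≤ J • Submodule.span R {x}}
  zero_mem' := ⟨0, fun n _ => by simp⟩
  add_mem' := by
    rintro x y ⟨k, hk⟩ ⟨l, hl⟩
    refine ⟨k + l, fun n hn => ?_⟩
    have hkl : I ^ (k + l) ≤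
        (J • Submodule.span R {x + y}).comap (LinearMap.toSpanSingleton R M (x + y)) := by
      rw [pow_add, Ideal.mul_le]
      intro a ha b hb
      have hax : a • x ∈ J • Submodule.span R {x} :=
        hk k le_rfl (Submodule.smul_mem_smul ha (Submodule.mem_span_singleton_self x))
      have hby : b • y ∈ J • Submodule.span R {y} :=
        hl l le_rfl (Submodule.smul_mem_smul hb (Submodule.mem_span_singleton_self y))
      obtain ⟨p, hp, hpx⟩ := Submodule.mem_smul_span_singleton.1 hax
      obtain ⟨q, hq, hqy⟩ := Submodule.mem_smul_span_singleton.1 hby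
      rw [Submodule.mem_comap, LinearMap.toSpanSingleton_apply,
        Submodule.mem_smul_span_singleton]
      refine ⟨a * q + p * b - p * q, sub_mem (add_mem (J.mul_mem_left _ hq)
        (J.mul_mem_right _ hp)) (J.mul_mem_left _ hq), ?_⟩
      have e1 : (a - p) • x = 0 := by rw [sub_smul, hpx, sub_self]
      have e2 : (b - q) • y = 0 := by rw [sub_smul, hqy, sub_self]
      have e3 : ((a - p) * (b - q)) • (x + y) = 0 := by
        rw [smul_add, mul_comm, mul_smul, e1, mul_comm, mul_smul, e2]
        simp
      have e4 : a * q + p * b - p * q = a * b - (a - p) * (b - q) := by ring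
      rw [e4, sub_smul, e3, sub_zero]
    refine (Submodule.smul_mono_left (Ideal.pow_le_pow_right hn)).trans ?_
    rw [Submodule.smul_le]
    intro r hr z hz
    obtain ⟨t, rfl⟩ := Submodule.mem_span_singleton.1 hz
    rw [smul_comm]
    exact Submodule.smul_mem _ t (hkl hr)
  smul_mem' := by
    rintro c x ⟨k, hk⟩
    refine ⟨k, fun n hn => ?_⟩
    have h : Submodule.span R {c • x} =
        (Submodule.span R {x}).map (LinearMap.lsmul R M c) := by
      rw [Submodule.map_span, Set.image_singleton, LinearMap.lsmul_apply]
    rw [h, ← Submodule.map_smul'', ← Submodule.map_smul'']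
    exact Submodule.map_mono (hk n hn)

namespace GrModule

variable {R : Type u} [CommRing R] {𝒜 : ℕ → AddSubgroup R}

/-- The cocycles `ker (Γ_{I,J}(Eⁱ) → Γ_{I,J}(Eⁱ⁺¹))`. -/
def StarInjectiveResolution.cocycles {M : GrModule 𝒜} (P : StarInjectiveResolution M)
    (I J : Ideal R) (i : ℕ) : Submodule R (P.E i) :=
  pairTorsion I J (P.E i) ⊓ LinearMap.ker (P.d i)

/-- The coboundaries `im (Γ_{I,J}(Eⁱ⁻¹) → Γ_{I,J}(Eⁱ))`, zero for `i = 0`. -/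
def StarInjectiveResolution.coboundaries {M : GrModule 𝒜} (P : StarInjectiveResolution M)
    (I J : Ideal R) : (i : ℕ) → Submodule R (P.E i)
  | 0 => ⊥
  | i + 1 => (pairTorsion I J (P.E i)).map (P.d i)

/-- The `i`-th cohomology module of `Γ_{I,J}(E^•)`. -/
abbrev StarInjectiveResolution.cohomology {M : GrModule 𝒜} (P : StarInjectiveResolution M)
    (I J : Ideal R) (i : ℕ) : Type u :=
  P.cocycles I J i ⧸ (P.coboundaries I J i).comap (P.cocycles I J i).subtype

/-- The degree-`n` part of the `i`-th cohomology module of `Γ_{I,J}(E^•)`: the `R₀`-submodule of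
classes of cocycles that are homogeneous of degree `n`. -/
def StarInjectiveResolution.cohomologyPiece [GradedRing 𝒜] {M : GrModule 𝒜}
    (P : StarInjectiveResolution M) (I J : Ideal R) (i : ℕ) (n : ℤ) :
    Submodule (baseRing 𝒜) (P.cohomology I J i) where
  carrier := {h | ∃ z : P.cocycles I J i, (z : P.E i) ∈ (P.E i).piece n ∧
    Submodule.Quotient.mk z = h}
  zero_mem' := ⟨0, zero_mem _, rfl⟩
  add_mem' := by
    rintro _ _ ⟨z, hz, rfl⟩ ⟨w, hw, rfl⟩
    exact ⟨z + w, add_mem hz hw, rfl⟩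
  smul_mem' := by
    rintro r _ ⟨z, hz, rfl⟩
    refine ⟨(r : R) • z, ?_, rfl⟩
    have := (P.E i).smul_mem' 0 n r z r.2 hz
    simpa using this

/-- The local cohomology module `Hⁱ_{I,J}(M)` with respect to a pair of ideals: the `i`-th right
derived functor of `Γ_{I,J}` on the category of graded `R`-modules. -/
abbrev localCohomology [GradedRing 𝒜] (M : GrModule 𝒜) (I J : Ideal R) (i : ℕ) : Type u :=
  M.injRes.cohomology I J i

/-- The graded component `Hⁱ_{I,J}(M)ₙ`, as an `R₀`-module. -/
noncomputable def localCohomologyPiece [GradedRing 𝒜] (M : GrModule 𝒜) (I J : Ideal R) (i : ℕ) (n : ℤ) :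
    Submodule (baseRing 𝒜) (M.localCohomology I J i) :=
  M.injRes.cohomologyPiece I J i n

/-- The cohomological dimension `cd(I, J, M) = sup {i : Hⁱ_{I,J}(M) ≠ 0}`
(the supremum of the empty set being `⊥`). -/
noncomputable def cohomologicalDim [GradedRing 𝒜] (M : GrModule 𝒜) (I J : Ideal R) :
    WithBot ℕ∞ :=
  sSup {x | ∃ i : ℕ, Nontrivial (M.localCohomology I J i) ∧ x = ((i : ℕ∞) : WithBot ℕ∞)}

end GrModule

/-- A family of components `(Tₙ)_{n ∈ ℤ}` is tame (asymptotically gap free) if `Tₙ = 0` for all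
`n ≪ 0` or `Tₙ ≠ 0` for all `n ≪ 0`. -/
def IsTame {S T : Type u} [Ring S] [AddCommGroup T] [Module S T] (P : ℤ → Submodule S T) : Prop :=
  (∃ n₀ : ℤ, ∀ n ≤ n₀, P n = ⊥) ∨ (∃ n₀ : ℤ, ∀ n ≤ n₀, P n ≠ ⊥)

/-- For all finite graded `R`-modules `N` and all `i`, `Hⁱ_{R₊,J}(N)ₙ = 0` for `n ≫ 0`. -/
def ComponentsEventuallyVanish {R : Type u} [CommRing R] (𝒜 : ℕ → AddSubgroup R) [GradedRing 𝒜]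
    (J : Ideal R) : Prop :=
  ∀ N : GrModule 𝒜, Module.Finite R N → ∀ i : ℕ,
    ∃ n₀ : ℤ, ∀ n ≥ n₀, N.localCohomologyPiece (irrelevantIdeal 𝒜) J i n = ⊥

/-- For all finite graded `R`-modules `N`, all `i` and all `n`, `Hⁱ_{R₊,J}(N)ₙ` is a finite
`R₀`-module. -/
def ComponentsFinite {R : Type u} [CommRing R] (𝒜 : ℕ → AddSubgroup R) [GradedRing 𝒜]
    (J : Ideal R) : Prop :=
  ∀ N : GrModule 𝒜, Module.Finite R N → ∀ (i : ℕ) (n : ℤ),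
    Module.Finite (baseRing 𝒜) (N.localCohomologyPiece (irrelevantIdeal 𝒜) J i n)

/-! On graded modules the torsion functor of the pair `(R₊, 𝔪₀R)` is ordinary `R₊`-torsion
(`mem_pairTorsion_iff`). Suppose `R₊ᵏ y ⊆ 𝔪₀R y`, and let `Q` be the annihilator of `y` modulo
torsion. Every monomial of degree `k` is then congruent to an element of `𝔪₀R` modulo `Q`. Once `Q`
is known to be homogeneous, taking degree-`k` parts gives `Rₖ ⊆ Q + 𝔪₀Rₖ`, and Nakayama over `R₀`
gives `Rₖ ⊆ Q`. Homogeneity of `Q` comes from an induction on the number of nontorsion components of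
`y`.

The cohomology in question is therefore graded local cohomology for `R₊`, which can be read off from
the Čech complex on degree-one generators of `R` (`cocycles_le_iff_cechSMulTop`). This uses that the
hulls in the resolution are Čech-acyclic (`cechVanish_hull`), together with dimension shifting along
cosyzygies. No comparison isomorphism is constructed. What is transferred is the statement `Z ≤ K •
Z ⊔ B` about cocycles and boundaries, that is `H = K H`; for `K = ⊥` it says `H = 0`.

For `c > 0` the top module `H = Hᶜ(M)` satisfies `H = R₊ H` (`cechSMulTop_top`). Indeed `M ⧸ R₊M` is
torsion and has no cohomology in degree `c`, so `H` is reached from `Hᶜ(R₊M)`. This in turn is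
reached from a finite power of `H`, through the map whose components are the generators, because
`Hᶜ⁺¹` vanishes on the kernel. That vanishing is `cechVanish_of_annihilator_le`: cohomological
dimension does not grow on passing to finite modules annihilated by `Ann M`.

In degree `n + 1` the equality `H = R₊ H` says that `Hₙ₊₁` is generated by the products of the
generators with `Hₙ`, so `Hₙ = 0` forces `Hₙ₊₁ = 0`. If `Hₙ` vanishes for arbitrarily negative `n`,
it vanishes for all `n`; otherwise it is nonzero for all `n ≪ 0`. For `c = 0` the module embeds in
`M`, which is bounded below. -/

/-! ### Localization at one element. -/

section Localization

variable {R : Type u} [CommRing R]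

/-- The localization of a module at the powers of an element. -/
abbrev Away (x : R) (M : Type u) [AddCommGroup M] [Module R M] : Type u :=
  LocalizedModule (Submonoid.powers x) M

variable {M N P : Type u} [AddCommGroup M] [Module R M] [AddCommGroup N] [Module R N]
  [AddCommGroup P] [Module R P]

/-- The localization map `M → M_x`. -/
noncomputable abbrev toAway (x : R) (M : Type u) [AddCommGroup M] [Module R M] :
    M →ₗ[R] Away x M :=
  LocalizedModule.mkLinearMap (Submonoid.powers x) M

/-- The localization of a linear map at the powers of an element. -/
noncomputable def awayMap (x : R) : (M →ₗ[R] N) →ₗ[R] (Away x M →ₗ[R] Away x N) :=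
  IsLocalizedModule.map (Submonoid.powers x) (toAway x M) (toAway x N)

theorem awayMap_toAway (x : R) (f : M →ₗ[R] N) (m : M) :
    awayMap x f (toAway x M m) = toAway x N (f m) :=
  IsLocalizedModule.map_apply _ _ _ _ _

theorem awayMap_comp (x : R) (g : N →ₗ[R] P) (f : M →ₗ[R] N) :
    awayMap x (g ∘ₗ f) = awayMap x g ∘ₗ awayMap x f :=
  IsLocalizedModule.map_comp' _ _ _ _ _ _

theorem awayMap_injective (x : R) (f : M →ₗ[R] N) (h : Function.Injective f) :
    Function.Injective (awayMap x f) :=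
  IsLocalizedModule.map_injective _ _ _ _ h

theorem awayMap_surjective (x : R) (f : M →ₗ[R] N) (h : Function.Surjective f) :
    Function.Surjective (awayMap x f) :=
  IsLocalizedModule.map_surjective _ _ _ _ h

theorem awayMap_exact (x : R) (f : M →ₗ[R] N) (g : N →ₗ[R] P) (h : Function.Exact f g) :
    Function.Exact (awayMap x f) (awayMap x g) :=
  IsLocalizedModule.map_exact _ _ _ _ _ _ h

theorem toAway_eq_zero (x : R) (m : M) : toAway x M m = 0 ↔ ∃ k : ℕ, x ^ k • m = 0 := by
  rw [IsLocalizedModule.eq_zero_iff (Submonoid.powers x)]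
  constructor
  · rintro ⟨⟨_, k, rfl⟩, h⟩
    exact ⟨k, h⟩
  · rintro ⟨k, h⟩
    exact ⟨⟨_, k, rfl⟩, h⟩

theorem exists_pow_smul_eq_toAway (x : R) (b : Away x M) :
    ∃ (k : ℕ) (m : M), x ^ k • b = toAway x M m := by
  obtain ⟨⟨m, ⟨_, k, rfl⟩⟩, h⟩ := IsLocalizedModule.surj (Submonoid.powers x) (toAway x M) b
  exact ⟨k, m, h⟩

theorem away_pow_smul_injective (x : R) (k : ℕ) {b b' : Away x M} (h : x ^ k • b = x ^ k • b') :
    b = b' :=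
  IsLocalizedModule.smul_injective (toAway x M) (⟨x ^ k, k, rfl⟩ : Submonoid.powers x) h

instance (x : R) [Subsingleton M] : Subsingleton (Away x M) := by
  refine ⟨fun a b => ?_⟩
  obtain ⟨k, m, hk⟩ := exists_pow_smul_eq_toAway x a
  obtain ⟨l, n, hl⟩ := exists_pow_smul_eq_toAway x b
  apply away_pow_smul_injective x (k + l)
  rw [pow_add, mul_comm, mul_smul, hk, mul_comm, mul_smul, hl, Subsingleton.elim m 0,
    Subsingleton.elim n 0]
  simp

end Localization

/-! ### Cochain complexes and the cone of `K → K_x`. -/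

/-- Cochain complexes of modules, indexed by the natural numbers. -/
structure CochainCx (R : Type u) [CommRing R] where
  X : ℕ → Type u
  [grp : ∀ n, AddCommGroup (X n)]
  [mod : ∀ n, Module R (X n)]
  d : ∀ n, X n →ₗ[R] X (n + 1)
  d_d : ∀ n x, d (n + 1) (d n x) = 0

attribute [instance] CochainCx.grp CochainCx.mod

namespace CochainCx

variable {R : Type u} [CommRing R]

/-- The complex with the module `N` in degree `1`. -/
def single (N : Type u) [AddCommGroup N] [Module R N] : CochainCx R where
  X n := match n with
    | 0 => PUnit
    | 1 => N
    | _ + 2 => PUnit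
  grp n := match n with
    | 0 => inferInstanceAs (AddCommGroup PUnit)
    | 1 => inferInstanceAs (AddCommGroup N)
    | _ + 2 => inferInstanceAs (AddCommGroup PUnit)
  mod n := match n with
    | 0 => (inferInstance : Module R PUnit.{u + 1})
    | 1 => (inferInstance : Module R N)
    | _ + 2 => (inferInstance : Module R PUnit.{u + 1})
  d _ := 0
  d_d _ _ := rfl

/-- The differential of the mapping cone of `K → K_x`. -/
noncomputable def coneD (x : R) (K : CochainCx R) (n : ℕ) :
    (K.X (n + 1) × Away x (K.X n)) →ₗ[R] K.X (n + 2) × Away x (K.X (n + 1)) :=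
  LinearMap.prod (K.d (n + 1) ∘ₗ LinearMap.fst R _ _)
    (toAway x _ ∘ₗ LinearMap.fst R _ _ - awayMap x (K.d n) ∘ₗ LinearMap.snd R _ _)

theorem coneD_apply (x : R) (K : CochainCx R) (n : ℕ) (a : K.X (n + 1)) (b : Away x (K.X n)) :
    coneD x K n (a, b) = (K.d (n + 1) a, toAway x _ a - awayMap x (K.d n) b) :=
  rfl

theorem awayMap_d_d (x : R) (K : CochainCx R) (n : ℕ) (b : Away x (K.X n)) :
    awayMap x (K.d (n + 1)) (awayMap x (K.d n) b) = 0 := by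
  have h : K.d (n + 1) ∘ₗ K.d n = 0 := LinearMap.ext (K.d_d n)
  rw [← LinearMap.comp_apply, ← awayMap_comp, h, map_zero, LinearMap.zero_apply]

/-- The shifted mapping cone of `K → K_x`, in degree `n + 1` equal to `Kⁿ⁺¹ × (Kⁿ)_x`. -/
noncomputable def cone (x : R) (K : CochainCx R) : CochainCx R where
  X n := match n with
    -- `K⁰` is discarded here. For Čech complexes this loses nothing: the module sits in degree `1`
    -- and degree `0` is trivial.
    | 0 => PUnit
    | n + 1 => K.X (n + 1) × Away x (K.X n)
  grp n := match n with
    | 0 => inferInstanceAs (AddCommGroup PUnit)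
    | n + 1 => inferInstanceAs (AddCommGroup (K.X (n + 1) × Away x (K.X n)))
  mod n := match n with
    | 0 => (inferInstance : Module R PUnit.{u + 1})
    | n + 1 => (inferInstance : Module R (K.X (n + 1) × Away x (K.X n)))
  d n := match n with
    | 0 => 0
    | n + 1 => coneD x K n
  d_d n := match n with
    | 0 => fun _ => map_zero (coneD x K 0)
    | n + 1 => by
      rintro ⟨a, b⟩
      change coneD x K (n + 1) (coneD x K n (a, b)) = 0
      rw [coneD_apply, coneD_apply, d_d, map_sub, awayMap_toAway, awayMap_d_d]
      simp

/-- The map of mapping cones induced by a family of linear maps. -/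
noncomputable def coneMap (x : R) {K L : CochainCx R} (f : ∀ n, K.X n →ₗ[R] L.X n) (n : ℕ) :
    (cone x K).X n →ₗ[R] (cone x L).X n :=
  match n with
  | 0 => 0
  | n + 1 => LinearMap.prodMap (f (n + 1)) (awayMap x (f n))

theorem coneMap_succ_apply (x : R) {K L : CochainCx R} (f : ∀ n, K.X n →ₗ[R] L.X n) (n : ℕ)
    (a : K.X (n + 1)) (b : Away x (K.X n)) :
    coneMap x f (n + 1) ((a, b) : K.X (n + 1) × Away x (K.X n)) =
      ((f (n + 1) a, awayMap x (f n) b) : L.X (n + 1) × Away x (L.X n)) :=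
  rfl

end CochainCx

open CochainCx

/-! ### The Čech complex as an iterated cone. -/

section Cech

variable {R : Type u} [CommRing R]

/-- The Čech complex of a module with respect to a list of elements, shifted so that the module
itself sits in degree `1`. -/
noncomputable def cech (N : Type u) [AddCommGroup N] [Module R N] : List R → CochainCx R
  | [] => single N
  | x :: xs => cone x (cech N xs)

variable {M N P : Type u} [AddCommGroup M] [Module R M] [AddCommGroup N] [Module R N]
  [AddCommGroup P] [Module R P]

/-- The map of Čech complexes induced by a linear map. -/
noncomputable def cechMap (f : M →ₗ[R] N) :
    (xs : List R) → (n : ℕ) → (cech M xs).X n →ₗ[R] (cech N xs).X n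
  | [], 0 => 0
  | [], 1 => f
  | [], _ + 2 => 0
  | x :: xs, n => coneMap x (cechMap f xs) n

theorem cechMap_add (f g : M →ₗ[R] N) (xs : List R) (n : ℕ) :
    cechMap (f + g) xs n = cechMap f xs n + cechMap g xs n := by
  induction xs generalizing n with
  | nil =>
    match n with
    | 0 => exact (add_zero 0).symm
    | 1 => rfl
    | n + 2 => exact (add_zero 0).symm
  | cons x xs ih =>
    match n with
    | 0 => exact (add_zero 0).symm
    | n + 1 =>
      refine LinearMap.ext ?_
      rintro ⟨a, b⟩
      change coneMap x _ _ _ = coneMap x _ _ _ + coneMap x _ _ _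
      simp only [coneMap_succ_apply, ih, map_add]
      rfl

theorem cechMap_smul (r : R) (f : M →ₗ[R] N) (xs : List R) (n : ℕ) :
    cechMap (r • f) xs n = r • cechMap f xs n := by
  induction xs generalizing n with
  | nil =>
    match n with
    | 0 => exact LinearMap.ext fun _ => rfl
    | 1 => rfl
    | n + 2 => exact LinearMap.ext fun _ => rfl
  | cons x xs ih =>
    match n with
    | 0 => exact LinearMap.ext fun _ => rfl
    | n + 1 =>
      refine LinearMap.ext ?_
      rintro ⟨a, b⟩
      change coneMap x _ _ _ = r • coneMap x _ _ _
      simp only [coneMap_succ_apply, ih, map_smul]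
      rfl

/-- The map of Čech complexes as a linear function of the underlying linear map. -/
noncomputable def cechMapₗ (M N : Type u) [AddCommGroup M] [Module R M] [AddCommGroup N]
    [Module R N] (xs : List R) (n : ℕ) :
    (M →ₗ[R] N) →ₗ[R] ((cech M xs).X n →ₗ[R] (cech N xs).X n) where
  toFun f := cechMap f xs n
  map_add' f g := cechMap_add f g xs n
  map_smul' r f := cechMap_smul r f xs n

theorem cechMap_comp (g : N →ₗ[R] P) (f : M →ₗ[R] N) (xs : List R) (n : ℕ) :
    cechMap (g ∘ₗ f) xs n = cechMap g xs n ∘ₗ cechMap f xs n := by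
  induction xs generalizing n with
  | nil =>
    match n with
    | 0 => rfl
    | 1 => rfl
    | n + 2 => rfl
  | cons x xs ih =>
    match n with
    | 0 => rfl
    | n + 1 =>
      refine LinearMap.ext ?_
      rintro ⟨a, b⟩
      change coneMap x _ _ _ = coneMap x _ _ (coneMap x _ _ _)
      simp only [coneMap_succ_apply, ih, awayMap_comp]
      rfl

theorem cechMap_d (f : M →ₗ[R] N) (xs : List R) (n : ℕ) (a : (cech M xs).X n) :
    cechMap f xs (n + 1) ((cech M xs).d n a) = (cech N xs).d n (cechMap f xs n a) := by
  induction xs generalizing n with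
  | nil => exact map_zero _
  | cons x xs ih =>
    match n, a with
    | 0, _ => exact map_zero _
    | n + 1, (a, b) =>
      have h : awayMap x (cechMap f xs (n + 1)) ∘ₗ awayMap x ((cech M xs).d n) =
          awayMap x ((cech N xs).d n) ∘ₗ awayMap x (cechMap f xs n) := by
        rw [← awayMap_comp, ← awayMap_comp]
        exact congrArg _ (LinearMap.ext (ih n))
      have h' := LinearMap.congr_fun h b
      simp only [LinearMap.comp_apply] at h'
      refine Prod.ext (ih (n + 1) a) ?_
      change awayMap x _ (toAway x _ a - awayMap x _ b) = toAway x _ _ - awayMap x _ (awayMap x _ b)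
      rw [map_sub, awayMap_toAway, h']
      rfl

theorem cechMap_injective (f : M →ₗ[R] N) (h : Function.Injective f) (xs : List R) (n : ℕ) :
    Function.Injective (cechMap f xs n) := by
  induction xs generalizing n with
  | nil =>
    match n with
    | 0 => exact Function.injective_of_subsingleton (α := PUnit) _
    | 1 => exact h
    | n + 2 => exact Function.injective_of_subsingleton (α := PUnit) _
  | cons x xs ih =>
    match n with
    | 0 => exact Function.injective_of_subsingleton (α := PUnit) _
    | n + 1 => exact (ih (n + 1)).prodMap (awayMap_injective x _ (ih n))

theorem cechMap_surjective (f : M →ₗ[R] N) (h : Function.Surjective f) (xs : List R) (n : ℕ) :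
    Function.Surjective (cechMap f xs n) := by
  induction xs generalizing n with
  | nil =>
    match n with
    | 0 => exact fun _ => ⟨PUnit.unit, rfl⟩
    | 1 => exact h
    | n + 2 => exact fun _ => ⟨PUnit.unit, rfl⟩
  | cons x xs ih =>
    match n with
    | 0 => exact fun _ => ⟨PUnit.unit, rfl⟩
    | n + 1 => exact (ih (n + 1)).prodMap (awayMap_surjective x _ (ih n))

theorem cechMap_exact (f : M →ₗ[R] N) (g : N →ₗ[R] P) (h : Function.Exact f g) (xs : List R)
    (n : ℕ) : Function.Exact (cechMap f xs n) (cechMap g xs n) := by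
  induction xs generalizing n with
  | nil =>
    match n with
    | 0 => exact fun _ => ⟨fun _ => ⟨PUnit.unit, rfl⟩, fun _ => rfl⟩
    | 1 => exact h
    | n + 2 => exact fun _ => ⟨fun _ => ⟨PUnit.unit, rfl⟩, fun _ => rfl⟩
  | cons x xs ih =>
    match n with
    | 0 => exact fun _ => ⟨fun _ => ⟨PUnit.unit, rfl⟩, fun _ => rfl⟩
    | n + 1 =>
      rintro ⟨a, b⟩
      have ha := ih (n + 1) a
      have hb := awayMap_exact x _ _ (ih n) b
      change ((_, _) : (cech P xs).X (n + 1) × Away x ((cech P xs).X n)) = (0, 0) ↔ _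
      rw [Prod.mk.injEq]
      refine (and_congr ha hb).trans ?_
      constructor
      · rintro ⟨⟨a', rfl⟩, ⟨b', rfl⟩⟩
        exact ⟨(a', b'), rfl⟩
      · rintro ⟨⟨a', b'⟩, hab⟩
        exact ⟨⟨a', congrArg Prod.fst hab⟩, ⟨b', congrArg Prod.snd hab⟩⟩

theorem cech_subsingleton_zero (xs : List R) : Subsingleton ((cech N xs).X 0) := by
  cases xs with
  | nil => exact inferInstanceAs (Subsingleton PUnit)
  | cons x xs => exact inferInstanceAs (Subsingleton PUnit)

theorem cech_subsingleton_of_lt (xs : List R) (n : ℕ) (h : xs.length + 1 < n) :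
    Subsingleton ((cech N xs).X n) := by
  induction xs generalizing n with
  | nil =>
    match n, h with
    | n + 2, _ => exact inferInstanceAs (Subsingleton PUnit)
  | cons x xs ih =>
    match n, h with
    | n + 1, h =>
      have h1 := ih (n + 1) (by simp at h; omega)
      have h2 := ih n (by simp at h; omega)
      exact inferInstanceAs (Subsingleton ((cech N xs).X (n + 1) × Away x ((cech N xs).X n)))

/-- The identification of a module with the degree `1` part of its Čech complex. -/
noncomputable def cechAug (N : Type u) [AddCommGroup N] [Module R N] :
    (xs : List R) → N →ₗ[R] (cech N xs).X 1
  | [] => LinearMap.id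
  | _ :: xs => LinearMap.prod (cechAug N xs) 0

theorem cechAug_bijective (xs : List R) : Function.Bijective (cechAug N xs) := by
  induction xs with
  | nil => exact Function.bijective_id
  | cons x xs ih =>
    have := cech_subsingleton_zero (N := N) xs
    constructor
    · intro a b hab
      exact ih.1 (congrArg Prod.fst hab)
    · rintro ⟨a, b⟩
      obtain ⟨c, rfl⟩ := ih.2 a
      exact ⟨c, Prod.ext rfl (Subsingleton.elim (α := Away x ((cech N xs).X 0)) _ _)⟩

theorem cechMap_aug (f : M →ₗ[R] N) (xs : List R) (m : M) :
    cechMap f xs 1 (cechAug M xs m) = cechAug N xs (f m) := by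
  induction xs with
  | nil => rfl
  | cons x xs ih =>
    exact Prod.ext ih (map_zero (awayMap x _))

/-- The elements annihilated by a power of each of the given elements. -/
def powerTorsion (xs : List R) (N : Type u) [AddCommGroup N] [Module R N] : Submodule R N where
  carrier := {a | ∀ x ∈ xs, ∃ k : ℕ, x ^ k • a = 0}
  zero_mem' _ _ := ⟨0, smul_zero _⟩
  add_mem' := by
    intro a b ha hb x hx
    obtain ⟨k, hk⟩ := ha x hx
    obtain ⟨l, hl⟩ := hb x hx
    refine ⟨k + l, ?_⟩
    rw [smul_add, pow_add, mul_smul _ _ b, hl, mul_comm, mul_smul, hk]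
    simp
  smul_mem' := by
    intro r a ha x hx
    obtain ⟨k, hk⟩ := ha x hx
    exact ⟨k, by rw [smul_comm, hk, smul_zero]⟩

theorem mem_powerTorsion {xs : List R} {a : N} :
    a ∈ powerTorsion xs N ↔ ∀ x ∈ xs, ∃ k : ℕ, x ^ k • a = 0 :=
  Iff.rfl

theorem mem_powerTorsion_of_injective {f : M →ₗ[R] N} (hf : Function.Injective f) {xs : List R}
    {a : M} : f a ∈ powerTorsion xs N ↔ a ∈ powerTorsion xs M := by
  simp only [mem_powerTorsion, ← map_smul, map_eq_zero_iff f hf]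

/-- Being zero in `N_x` means being killed by a power of `x`, so the zeroth Čech cohomology is the
torsion submodule. -/
theorem cech_d_aug_eq_zero (xs : List R) (a : N) :
    (cech N xs).d 1 (cechAug N xs a) = 0 ↔ a ∈ powerTorsion xs N := by
  induction xs with
  | nil => exact ⟨fun _ _ h => absurd h List.not_mem_nil, fun _ => rfl⟩
  | cons x xs ih =>
    change coneD x (cech N xs) 0 (cechAug N xs a, 0) = (0, 0) ↔ _
    rw [coneD_apply, Prod.mk.injEq, ih, map_zero, sub_zero, toAway_eq_zero]
    simp only [← map_smul, map_eq_zero_iff _ (cechAug_bijective xs).1, mem_powerTorsion,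
      List.forall_mem_cons]
    exact and_comm

/-- Beyond the module itself, every term is built from localizations at some of the `x ∈ xs`, and
these are zero on a torsion module. -/
theorem cech_subsingleton_of_torsion (xs : List R) (h : powerTorsion xs N = ⊤) (n : ℕ) :
    Subsingleton ((cech N xs).X (n + 2)) := by
  induction xs generalizing n with
  | nil => exact inferInstanceAs (Subsingleton PUnit)
  | cons x xs ih =>
    have h' : powerTorsion xs N = ⊤ := by
      rw [eq_top_iff] at h ⊢
      exact fun a ha y hy => h ha y (List.mem_cons_of_mem _ hy)
    have h1 := ih h' n
    have h2 : Subsingleton (Away x ((cech N xs).X (n + 1))) := by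
      match n with
      | 0 =>
        refine subsingleton_of_forall_eq 0 fun b => ?_
        obtain ⟨k, m, hk⟩ := exists_pow_smul_eq_toAway x b
        obtain ⟨a, rfl⟩ := (cechAug_bijective xs).2 m
        apply away_pow_smul_injective x k
        rw [hk, smul_zero, toAway_eq_zero]
        obtain ⟨l, hl⟩ := (h.ge (Submodule.mem_top (x := a))) x List.mem_cons_self
        exact ⟨l, by rw [← map_smul, hl, map_zero]⟩
      | n + 1 =>
        have := ih h' n
        infer_instance
    exact inferInstanceAs (Subsingleton ((cech N xs).X (n + 2) × Away x ((cech N xs).X (n + 1))))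

end Cech

/-! ### Čech cohomology on elements: long exact sequence and dimension shifting. -/

section LongExact

variable {R : Type u} [CommRing R]

/-- The cocycles of degree `n` of the Čech complex. -/
noncomputable def cechCocycles (xs : List R) (N : Type u) [AddCommGroup N] [Module R N] (n : ℕ) :
    Submodule R ((cech N xs).X (n + 1)) :=
  LinearMap.ker ((cech N xs).d (n + 1))

/-- The coboundaries of degree `n` of the Čech complex. -/
noncomputable def cechBoundaries (xs : List R) (N : Type u) [AddCommGroup N] [Module R N] (n : ℕ) :
    Submodule R ((cech N xs).X (n + 1)) :=
  LinearMap.range ((cech N xs).d n)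

/-- The Čech cohomology module `Hⁿ` satisfies `Hⁿ = I Hⁿ`. -/
def CechSMulTop (xs : List R) (I : Ideal R) (n : ℕ) (N : Type u) [AddCommGroup N]
    [Module R N] : Prop :=
  cechCocycles xs N n ≤ I • cechCocycles xs N n ⊔ cechBoundaries xs N n

/-- The Čech cohomology module `Hⁿ` vanishes. -/
def CechVanish (xs : List R) (n : ℕ) (N : Type u) [AddCommGroup N] [Module R N] : Prop :=
  cechCocycles xs N n ≤ cechBoundaries xs N n

/-- Allows vanishing and the property `H = I H` to be transported by the same dimension-shifting
lemmas. -/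
theorem cechSMulTop_bot {xs : List R} {n : ℕ} {N : Type u} [AddCommGroup N] [Module R N] :
    CechSMulTop xs ⊥ n N ↔ CechVanish xs n N := by
  rw [CechSMulTop, CechVanish, Submodule.bot_smul, bot_sup_eq]

variable {A B C : Type u} [AddCommGroup A] [Module R A] [AddCommGroup B] [Module R B]
  [AddCommGroup C] [Module R C] {f : A →ₗ[R] B} {g : B →ₗ[R] C} {xs : List R}

theorem mem_cechCocycles {n : ℕ} {z : (cech A xs).X (n + 1)} :
    z ∈ cechCocycles xs A n ↔ (cech A xs).d (n + 1) z = 0 :=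
  LinearMap.mem_ker

theorem cechMap_mem_cocycles (f : A →ₗ[R] B) {n : ℕ} {z : (cech A xs).X (n + 1)}
    (hz : z ∈ cechCocycles xs A n) : cechMap f xs (n + 1) z ∈ cechCocycles xs B n := by
  rw [mem_cechCocycles] at hz ⊢
  rw [← cechMap_d, hz, map_zero]

theorem mem_cechCocycles_of_map (hf : Function.Injective f) {n : ℕ} {z : (cech A xs).X (n + 1)}
    (hz : cechMap f xs (n + 1) z ∈ cechCocycles xs B n) : z ∈ cechCocycles xs A n := by
  rw [mem_cechCocycles] at hz ⊢
  rwa [← cechMap_d, map_eq_zero_iff _ (cechMap_injective f hf xs _)] at hz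

theorem cechMap_mem_boundaries (f : A →ₗ[R] B) {n : ℕ} {z : (cech A xs).X (n + 1)}
    (hz : z ∈ cechBoundaries xs A n) : cechMap f xs (n + 1) z ∈ cechBoundaries xs B n := by
  obtain ⟨w, rfl⟩ := hz
  exact ⟨cechMap f xs n w, (cechMap_d f xs n w).symm⟩

theorem cechBoundaries_le_cocycles (n : ℕ) : cechBoundaries xs A n ≤ cechCocycles xs A n := by
  rintro _ ⟨w, rfl⟩
  exact (cech A xs).d_d n w

/-- Exactness of `Hⁿ(A) → Hⁿ(B) → Hⁿ(C)`. -/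
theorem cech_exact_middle (hf : Function.Injective f) (hfg : Function.Exact f g)
    (hg : Function.Surjective g) {n : ℕ} {z : (cech B xs).X (n + 1)}
    (hz : z ∈ cechCocycles xs B n) (hgz : cechMap g xs (n + 1) z ∈ cechBoundaries xs C n) :
    ∃ a ∈ cechCocycles xs A n, z - cechMap f xs (n + 1) a ∈ cechBoundaries xs B n := by
  obtain ⟨w, hw⟩ := hgz
  obtain ⟨w, rfl⟩ := cechMap_surjective g hg xs n w
  obtain ⟨a, ha⟩ := (cechMap_exact f g hfg xs (n + 1) (z - (cech B xs).d n w)).1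
    (by rw [map_sub, cechMap_d, hw, sub_self])
  refine ⟨a, mem_cechCocycles_of_map hf ?_, w, ?_⟩
  · rw [ha]
    exact sub_mem hz (cechBoundaries_le_cocycles n ⟨w, rfl⟩)
  · rw [ha, sub_sub_cancel]

/-- The connecting map, on elements. -/
theorem cech_connecting (hf : Function.Injective f) (hfg : Function.Exact f g)
    (hg : Function.Surjective g) {n : ℕ} {c : (cech C xs).X (n + 1)}
    (hc : c ∈ cechCocycles xs C n) :
    ∃ b, cechMap g xs (n + 1) b = c ∧ ∃ a ∈ cechCocycles xs A (n + 1),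
      cechMap f xs (n + 2) a = (cech B xs).d (n + 1) b := by
  obtain ⟨b, rfl⟩ := cechMap_surjective g hg xs (n + 1) c
  obtain ⟨a, ha⟩ := (cechMap_exact f g hfg xs (n + 2) ((cech B xs).d (n + 1) b)).1
    (by rw [cechMap_d]; exact hc)
  refine ⟨b, rfl, a, mem_cechCocycles_of_map hf ?_, ha⟩
  rw [ha]
  exact cechBoundaries_le_cocycles (n + 1) ⟨b, rfl⟩

/-- If `Hⁿ⁺¹(A) = 0`, then `Hⁿ(B) → Hⁿ(C)` is surjective. -/
theorem cech_lift_cocycle (hf : Function.Injective f) (hfg : Function.Exact f g)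
    (hg : Function.Surjective g) {n : ℕ} (hA : CechVanish xs (n + 1) A)
    {c : (cech C xs).X (n + 1)} (hc : c ∈ cechCocycles xs C n) :
    ∃ b ∈ cechCocycles xs B n, cechMap g xs (n + 1) b = c := by
  obtain ⟨b, hb, a, ha, hab⟩ := cech_connecting hf hfg hg hc
  obtain ⟨a', rfl⟩ := hA ha
  refine ⟨b - cechMap f xs (n + 1) a', ?_, ?_⟩
  · rw [mem_cechCocycles, map_sub, ← hab, ← cechMap_d, sub_self]
  · rw [map_sub, hb, (cechMap_exact f g hfg xs (n + 1)).apply_apply_eq_zero, sub_zero]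

/-- The connecting relation is linear, so it carries `I`-multiples of cocycles to `I`-multiples of
cocycles. -/
theorem cech_smul_connecting (hf : Function.Injective f) (hfg : Function.Exact f g)
    (hg : Function.Surjective g) {n : ℕ} (I : Ideal R) {c : (cech C xs).X (n + 1)}
    (hc : c ∈ I • cechCocycles xs C n) :
    ∃ b, cechMap g xs (n + 1) b = c ∧ ∃ a ∈ I • cechCocycles xs A (n + 1),
      cechMap f xs (n + 2) a = (cech B xs).d (n + 1) b := by
  induction hc using Submodule.smul_induction_on' with
  | smul r hr c hc =>
    obtain ⟨b, rfl, a, ha, hab⟩ := cech_connecting hf hfg hg hc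
    exact ⟨r • b, map_smul _ _ _, r • a, Submodule.smul_mem_smul hr ha, by
      rw [map_smul, map_smul, hab]⟩
  | add c _ c' _ h h' =>
    obtain ⟨b, rfl, a, ha, hab⟩ := h
    obtain ⟨b', rfl, a', ha', hab'⟩ := h'
    exact ⟨b + b', map_add _ _ _, a + a', add_mem ha ha', by rw [map_add, map_add, hab, hab']⟩

/-- Since `Hⁿ⁺¹(B) = 0`, every class of `A` is hit by the connecting map. Choosing a preimage for
each cocycle and extending linearly respects multiplication by `I`. -/
theorem cech_smul_connecting_inv (hfg : Function.Exact f g)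
    {n : ℕ} (hB : CechVanish xs (n + 1) B) (I : Ideal R)
    {a : (cech A xs).X (n + 2)} (ha : a ∈ I • cechCocycles xs A (n + 1)) :
    ∃ b, cechMap g xs (n + 1) b ∈ I • cechCocycles xs C n ∧
      cechMap f xs (n + 2) a = (cech B xs).d (n + 1) b := by
  induction ha using Submodule.smul_induction_on' with
  | smul r hr a ha =>
    obtain ⟨b, hb⟩ := hB (cechMap_mem_cocycles f ha)
    refine ⟨r • b, ?_, by rw [map_smul, map_smul, hb]⟩
    rw [map_smul]
    refine Submodule.smul_mem_smul hr ?_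
    rw [mem_cechCocycles, ← cechMap_d, hb, (cechMap_exact f g hfg xs (n + 2)).apply_apply_eq_zero]
  | add a _ a' _ h h' =>
    obtain ⟨b, hb, hab⟩ := h
    obtain ⟨b', hb', hab'⟩ := h'
    exact ⟨b + b', by rw [map_add]; exact add_mem hb hb', by rw [map_add, map_add, hab, hab']⟩

/-- Dimension shifting: if `Hⁿ⁺¹(B) = 0`, then `Hⁿ⁺¹(A)` is the cokernel of `Hⁿ(B) → Hⁿ(C)`. -/
theorem cechSMulTop_succ_iff (hf : Function.Injective f) (hfg : Function.Exact f g)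
    (hg : Function.Surjective g) {n : ℕ} (hB : CechVanish xs (n + 1) B) (I : Ideal R) :
    CechSMulTop xs I (n + 1) A ↔ cechCocycles xs C n ≤ I • cechCocycles xs C n ⊔
      ((cechCocycles xs B n).map (cechMap g xs (n + 1)) ⊔ cechBoundaries xs C n) := by
  constructor
  · intro h c hc
    obtain ⟨b, rfl, a, ha, hab⟩ := cech_connecting hf hfg hg hc
    obtain ⟨a₁, ha₁, _, ⟨a₂, rfl⟩, rfl⟩ := Submodule.mem_sup.1 (h ha)
    obtain ⟨b₁, hb₁, hab₁⟩ := cech_smul_connecting_inv hfg hB I ha₁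
    refine Submodule.mem_sup.2 ⟨_, hb₁, _, Submodule.mem_sup_left ⟨b - b₁ - cechMap f xs (n + 1) a₂,
      ?_, rfl⟩, ?_⟩
    · change (cech B xs).d (n + 1) _ = 0
      rw [map_sub, map_sub, ← hab, ← hab₁, map_add, cechMap_d]
      abel
    · rw [map_sub, map_sub, (cechMap_exact f g hfg xs (n + 1)).apply_apply_eq_zero]
      abel
  · intro h a ha
    obtain ⟨b, hb⟩ := hB (cechMap_mem_cocycles f ha)
    have hgb : cechMap g xs (n + 1) b ∈ cechCocycles xs C n := by
      rw [mem_cechCocycles, ← cechMap_d, hb,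
        (cechMap_exact f g hfg xs (n + 2)).apply_apply_eq_zero]
    obtain ⟨c, hc, _, hy, hcy⟩ := Submodule.mem_sup.1 (h hgb)
    obtain ⟨_, ⟨b', hb', rfl⟩, _, ⟨w, rfl⟩, rfl⟩ := Submodule.mem_sup.1 hy
    obtain ⟨b₁, rfl, a₁, ha₁, hab₁⟩ := cech_smul_connecting hf hfg hg I hc
    obtain ⟨w, rfl⟩ := cechMap_surjective g hg xs n w
    -- The four terms cancel under `g`, so the difference comes from `A`. Its differential accounts
    -- for `a - a₁`.
    obtain ⟨a₂, ha₂⟩ := (cechMap_exact f g hfg xs (n + 1) (b - b₁ - b' - (cech B xs).d n w)).1 (by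
      rw [map_sub, map_sub, map_sub, cechMap_d, ← hcy]
      abel)
    refine Submodule.mem_sup.2 ⟨a₁, ha₁, _, ⟨a₂, rfl⟩, ?_⟩
    apply cechMap_injective f hf xs (n + 2)
    have hb'0 : (cech B xs).d (n + 1) b' = 0 := hb'
    rw [map_add, hab₁, cechMap_d, ha₂, ← hb, map_sub, map_sub, map_sub, CochainCx.d_d, hb'0]
    abel

/-- With `Hⁿ(B)` zero as well, the cokernel of `Hⁿ(B) → Hⁿ(C)` is all of `Hⁿ(C)`. -/
theorem cechSMulTop_shift (hf : Function.Injective f) (hfg : Function.Exact f g)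
    (hg : Function.Surjective g) {n : ℕ} (hB : CechVanish xs (n + 1) B) (hB' : CechVanish xs n B)
    (I : Ideal R) : CechSMulTop xs I (n + 1) A ↔ CechSMulTop xs I n C := by
  have h : (cechCocycles xs B n).map (cechMap g xs (n + 1)) ≤ cechBoundaries xs C n := by
    rintro _ ⟨b, hb, rfl⟩
    exact cechMap_mem_boundaries g (hB' hb)
  rw [cechSMulTop_succ_iff hf hfg hg hB I, CechSMulTop, sup_eq_right.2 h]

theorem cechCocycles_zero (xs : List R) (N : Type u) [AddCommGroup N] [Module R N] :
    cechCocycles xs N 0 = (powerTorsion xs N).map (cechAug N xs) := by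
  ext z
  obtain ⟨a, rfl⟩ := (cechAug_bijective xs).2 z
  rw [mem_cechCocycles, cech_d_aug_eq_zero, Submodule.mem_map]
  constructor
  · exact fun h => ⟨a, h, rfl⟩
  · rintro ⟨b, hb, hab⟩
    rwa [← (cechAug_bijective xs).1 hab]

theorem cechBoundaries_zero (xs : List R) (N : Type u) [AddCommGroup N] [Module R N] :
    cechBoundaries xs N 0 = ⊥ := by
  have := cech_subsingleton_zero (N := N) xs
  rw [eq_bot_iff]
  rintro _ ⟨w, rfl⟩
  rw [Subsingleton.elim w 0, map_zero]
  exact zero_mem _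

/-- The last shift, where `H⁰(B)` is torsion and usually nonzero: `H¹(A)` is the cokernel of `Γ(B) →
Γ(C)`. This is the form in which derived-functor cohomology appears. -/
theorem cechSMulTop_one_iff (hf : Function.Injective f) (hfg : Function.Exact f g)
    (hg : Function.Surjective g) (hB : CechVanish xs 1 B) (I : Ideal R) :
    CechSMulTop xs I 1 A ↔
      powerTorsion xs C ≤ I • powerTorsion xs C ⊔ (powerTorsion xs B).map g := by
  have hcomp : cechMap g xs 1 ∘ₗ cechAug B xs = cechAug C xs ∘ₗ g :=
    LinearMap.ext (cechMap_aug g xs)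
  rw [cechSMulTop_succ_iff hf hfg hg hB I, cechCocycles_zero, cechCocycles_zero,
    cechBoundaries_zero, sup_bot_eq, ← Submodule.map_comp, hcomp, Submodule.map_comp,
    ← Submodule.map_smul'', ← Submodule.map_sup,
    Submodule.map_le_map_iff_of_injective (cechAug_bijective xs).1]

/-- On a trivial module the zero map is injective, so it induces an injective map of complexes; by
linearity that induced map is zero. -/
theorem cechVanish_of_subsingleton {n : ℕ} [Subsingleton A] : CechVanish xs n A := by
  intro z _
  have h : z = 0 := by
    apply cechMap_injective (0 : A →ₗ[R] A) (Function.injective_of_subsingleton _) xs (n + 1)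
    change cechMapₗ A A xs (n + 1) 0 z = cechMapₗ A A xs (n + 1) 0 0
    rw [map_zero]
    rfl
  rw [h]
  exact zero_mem _

/-- Exactness in the middle for vanishing. -/
theorem CechVanish.middle (hf : Function.Injective f) (hfg : Function.Exact f g)
    (hg : Function.Surjective g) {n : ℕ} (hA : CechVanish xs n A) (hC : CechVanish xs n C) :
    CechVanish xs n B := by
  intro z hz
  obtain ⟨a, ha, h⟩ := cech_exact_middle hf hfg hg hz (hC (cechMap_mem_cocycles g hz))
  rw [← sub_add_cancel z (cechMap f xs (n + 1) a)]
  exact add_mem h (cechMap_mem_boundaries f (hA ha))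

theorem CechVanish.of_equiv (e : A ≃ₗ[R] B) {n : ℕ} (hB : CechVanish xs n B) :
    CechVanish xs n A := by
  refine CechVanish.middle (f := (0 : PUnit.{u + 1} →ₗ[R] A)) (g := e.toLinearMap)
    (Function.injective_of_subsingleton _) (fun y => ?_) e.surjective cechVanish_of_subsingleton hB
  simp [eq_comm (a := (0 : A))]

theorem cechVanish_of_length_lt {n : ℕ} (h : xs.length < n) : CechVanish xs n A := by
  intro z _
  have := cech_subsingleton_of_lt (N := A) xs (n + 1) (by omega)
  rw [Subsingleton.elim z 0]
  exact zero_mem _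

theorem cechVanish_of_torsion {n : ℕ} (h : powerTorsion xs A = ⊤) : CechVanish xs (n + 1) A := by
  intro z _
  have := cech_subsingleton_of_torsion xs h n
  rw [Subsingleton.elim z 0]
  exact zero_mem _

/-- If `Hⁿ⁺¹(ker g) = 0`, then `Hⁿ(B) → Hⁿ(C)` is surjective. -/
theorem cech_lift_cocycle_of_ker (hg : Function.Surjective g) {n : ℕ}
    (hA : CechVanish xs (n + 1) (LinearMap.ker g))
    {c : (cech C xs).X (n + 1)} (hc : c ∈ cechCocycles xs C n) :
    ∃ b ∈ cechCocycles xs B n, cechMap g xs (n + 1) b = c :=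
  cech_lift_cocycle (LinearMap.ker g).injective_subtype (LinearMap.exact_subtype_ker_map g) hg hA hc

/-- Right exactness of `Hⁿ` when `Hⁿ⁺¹` of the kernel vanishes. -/
theorem CechVanish.of_surjective (hg : Function.Surjective g) {n : ℕ}
    (hA : CechVanish xs (n + 1) (LinearMap.ker g)) (hB : CechVanish xs n B) :
    CechVanish xs n C := by
  intro c hc
  obtain ⟨b, hb, rfl⟩ := cech_lift_cocycle_of_ker hg hA hc
  exact cechMap_mem_boundaries g (hB hb)

end LongExact

/-! ### Comparison of cohomological dimensions, and divisibility of the top cohomology. -/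

section CohomologicalDimension

variable {R : Type u} [CommRing R] [IsNoetherianRing R] {xs : List R}

/-- If `Hⁿ` vanishes on the residue rings `R ⧸ p` with `p ⊇ I` prime, then it vanishes on all
finite modules annihilated by `I`. -/
theorem cechVanish_of_primes {n : ℕ} {I : Ideal R}
    (h : ∀ p : Ideal R, p.IsPrime → I ≤ p → CechVanish xs n (R ⧸ p))
    {N : Type u} [AddCommGroup N] [Module R N] [hN : Module.Finite R N]
    (hI : I ≤ Module.annihilator R N) : CechVanish xs n N := by
  revert hI
  induction hN using IsNoetherianRing.induction_on_isQuotientEquivQuotientPrime R with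
  | subsingleton N => exact fun _ => cechVanish_of_subsingleton
  | quotient N p e =>
    intro hI
    rw [e.annihilator_eq, Ideal.annihilator_quotient] at hI
    exact (h p.1 p.2 hI).of_equiv e
  | exact N₁ N₂ N₃ f g hf hg hfg h₁ h₃ =>
    intro hI
    exact (h₁ (hI.trans (f.annihilator_le_of_injective hf))).middle hf hfg hg
      (h₃ (hI.trans (g.annihilator_le_of_surjective hg)))

/-- For a prime `p` containing the annihilator of a finite module `M`, there is a quotient `Q` of
`M`, an element `a ∉ p` and an element `q ∈ Q` with annihilator `p` and `aQ ⊆ Rq`. -/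
theorem exists_quotient_smul_le_span {M : Type u} [AddCommGroup M] [Module R M]
    [Module.Finite R M] (p : Ideal R) [hp : p.IsPrime] (hM : Module.annihilator R M ≤ p) :
    ∃ (L : Submodule R M) (m : M) (a : R), a ∉ p ∧ p • (⊤ : Submodule R M) ≤ L ∧
      (∀ r, r • m ∈ L ↔ r ∈ p) ∧ ∀ y, a • y ∈ L ⊔ Submodule.span R {m} := by
  let S : Set (Submodule R M) :=
    {L | p • (⊤ : Submodule R M) ≤ L ∧ ∀ a, (∀ y, a • y ∈ L) → a ∈ p}
  -- `p M` belongs to `S`: since `p` contains `Ann M`, it lies in the support of `M ⧸ p M`, hence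
  -- contains the annihilator of that module.
  have hS : S.Nonempty := by
    refine ⟨p • ⊤, le_rfl, fun a ha => ?_⟩
    have h1 : (⟨p, hp⟩ : PrimeSpectrum R) ∈ Module.support R (M ⧸ p • (⊤ : Submodule R M)) := by
      rw [Module.support_quotient]
      exact ⟨Module.mem_support_iff_of_finite.2 hM, fun _ hx => hx⟩
    refine Module.mem_support_iff_of_finite.1 h1 ?_
    rw [Module.mem_annihilator]
    intro y
    obtain ⟨y, rfl⟩ := Submodule.mkQ_surjective _ y
    rw [← map_smul, Submodule.mkQ_apply, Submodule.Quotient.mk_eq_zero]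
    exact ha y
  obtain ⟨L, ⟨hL1, hL2⟩, hmax⟩ :=
    WellFounded.has_min (r := (· > · : Submodule R M → Submodule R M → Prop)) wellFounded_gt S hS
  have hne : L ≠ ⊤ := by
    rintro rfl
    exact hp.ne_top ((Ideal.eq_top_iff_one _).2 (hL2 1 fun _ => Submodule.mem_top))
  have key : ∀ m, m ∉ L → ∃ a, a ∉ p ∧ ∀ y, a • y ∈ L ⊔ Submodule.span R {m} := by
    intro m hm
    by_contra! hcon
    refine hmax (L ⊔ Submodule.span R {m}) ⟨hL1.trans le_sup_left, fun a ha => ?_⟩ ?_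
    · by_contra hap
      obtain ⟨y, hy⟩ := hcon a hap
      exact hy (ha y)
    · refine lt_of_le_of_ne le_sup_left fun h => hm ?_
      rw [h]
      exact Submodule.mem_sup_right (Submodule.mem_span_singleton_self m)
  obtain ⟨m, hm⟩ : ∃ m, m ∉ L := by
    by_contra! h
    exact hne (eq_top_iff.2 fun y _ => h y)
  obtain ⟨a, hap, ha⟩ := key m hm
  refine ⟨L, m, a, hap, hL1, fun r => ⟨fun hr => ?_, fun hr =>
    hL1 (Submodule.smul_mem_smul hr Submodule.mem_top)⟩, ha⟩
  -- If `r m ∈ L`, then `r a M ⊆ r (L + R m) ⊆ L`, and the choice of `L` puts `r a` in `p`.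
  have : r * a ∈ p := by
    refine hL2 _ fun y => ?_
    obtain ⟨l, hl, z, hz, hlz⟩ := Submodule.mem_sup.1 (ha y)
    obtain ⟨t, rfl⟩ := Submodule.mem_span_singleton.1 hz
    rw [mul_smul, ← hlz, smul_add, smul_comm]
    exact add_mem (L.smul_mem _ hl) (L.smul_mem _ hr)
  exact (hp.mem_or_mem this).resolve_right hap

/-- Descending step of the comparison of cohomological dimensions. -/
theorem cechVanish_step {M : Type u} [AddCommGroup M] [Module R M] [Module.Finite R M] {n : ℕ}
    (hM : CechVanish xs n M)
    (h : ∀ (N : Type u) [AddCommGroup N] [Module R N] [Module.Finite R N],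
      Module.annihilator R M ≤ Module.annihilator R N → CechVanish xs (n + 1) N)
    {N : Type u} [AddCommGroup N] [Module R N] [Module.Finite R N]
    (hN : Module.annihilator R M ≤ Module.annihilator R N) : CechVanish xs n N := by
  refine cechVanish_of_primes (fun p => ?_) hN
  -- Noetherian induction: primes strictly larger than `p` are already settled.
  induction p using WellFoundedGT.induction with
  | _ p ih =>
  intro hp hMp
  obtain ⟨L, m, a, hap, hL, hm, ha⟩ := exists_quotient_smul_le_span p hMp
  -- the ideal of all `r` with `r m ∈ a M + L`
  let J : Ideal R := (LinearMap.range (a • L.mkQ)).comap (LinearMap.toSpanSingleton R _ (L.mkQ m))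
  have hmem : ∀ r, r ∈ J ↔ ∃ y, a • L.mkQ y = r • L.mkQ m := fun r => Iff.rfl
  have hpJ : p ≤ J := fun r hr => (hmem r).2 ⟨0, by
    rw [map_zero, smul_zero, ← map_smul, eq_comm, Submodule.mkQ_apply,
      Submodule.Quotient.mk_eq_zero]
    exact (hm r).2 hr⟩
  have haJ : a ∈ J := (hmem a).2 ⟨m, rfl⟩
  -- `J / p` is a quotient of `M`
  have hex : ∀ y : M, ∃ r : R, a • L.mkQ y = r • L.mkQ m := by
    intro y
    obtain ⟨l, hl, z, hz, hlz⟩ := Submodule.mem_sup.1 (ha y)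
    obtain ⟨t, rfl⟩ := Submodule.mem_span_singleton.1 hz
    refine ⟨t, ?_⟩
    rw [← map_smul, ← hlz, map_add, map_smul, Submodule.mkQ_apply,
      (Submodule.Quotient.mk_eq_zero L).2 hl, zero_add]
  let ψ : (R ⧸ p) →ₗ[R] M ⧸ L := Submodule.liftQ p (LinearMap.toSpanSingleton R _ (L.mkQ m))
    (fun r hr => by
      rw [LinearMap.mem_ker, LinearMap.toSpanSingleton_apply, ← map_smul, Submodule.mkQ_apply,
        Submodule.Quotient.mk_eq_zero]
      exact (hm r).2 hr)
  have hψ : ∀ r : R, ψ (Submodule.Quotient.mk r) = r • L.mkQ m := fun r => rfl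
  have hψinj : Function.Injective ψ := by
    rw [injective_iff_map_eq_zero]
    intro r hr
    obtain ⟨r, rfl⟩ := Submodule.Quotient.mk_surjective p r
    rw [hψ, ← map_smul, Submodule.mkQ_apply, Submodule.Quotient.mk_eq_zero] at hr
    exact (Submodule.Quotient.mk_eq_zero p).2 ((hm r).1 hr)
  let W : Submodule R (M ⧸ L) := LinearMap.range (a • L.mkQ)
  let V : Submodule R (R ⧸ p) := W.comap ψ
  -- `W = a (M ⧸ L)` is an image of `M`, and the kernel is annihilated by `Ann M`, so right
  -- exactness of `Hⁿ` applies.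
  have hW : CechVanish xs n W := by
    refine CechVanish.of_surjective (LinearMap.surjective_rangeRestrict (a • L.mkQ)) (h _ ?_) hM
    exact (LinearMap.ker _).subtype.annihilator_le_of_injective (Submodule.injective_subtype _)
  -- `a (M ⧸ L)` lies in the cyclic submodule generated by the class of `m`, a copy of `R ⧸ p`;
  -- hence `W ≅ V = J ⧸ p`.
  have hWV : ∀ w : W, ∃ v : V, ψ v = w := by
    rintro ⟨_, y, rfl⟩
    obtain ⟨r, hr⟩ := hex y
    refine ⟨⟨Submodule.Quotient.mk r, ?_⟩, ?_⟩
    · exact ⟨y, by rw [hψ, ← hr]; rfl⟩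
    · exact hr.symm
  let e : V →ₗ[R] W := ψ.restrict (p := V) (q := W) fun v hv => hv
  have he : Function.Bijective e := by
    constructor
    · intro v v' hv
      exact Subtype.ext (hψinj (congrArg Subtype.val hv))
    · intro w
      obtain ⟨v, hv⟩ := hWV w
      exact ⟨v, Subtype.ext hv⟩
  have hV : CechVanish xs n V := hW.of_equiv (LinearEquiv.ofBijective e he)
  -- This quotient is killed by `p` and by `a ∉ p`, so only primes strictly above `p` occur in its
  -- filtration.
  have hquot : CechVanish xs n ((R ⧸ p) ⧸ V) := by
    refine cechVanish_of_primes (I := p ⊔ Ideal.span {a}) (fun q hq hpq => ?_) ?_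
    · have hlt : p < q := lt_of_le_of_ne (le_sup_left.trans hpq) fun hpq' =>
        hap (hpq' ▸ hpq (Submodule.mem_sup_right (Ideal.mem_span_singleton_self a)))
      exact ih q hlt hq (hMp.trans hlt.le)
    · have hz : ∀ r ∈ J, r ∈ Module.annihilator R ((R ⧸ p) ⧸ V) := by
        intro r hr
        rw [Module.mem_annihilator]
        intro y
        obtain ⟨y, rfl⟩ := V.mkQ_surjective y
        obtain ⟨y, rfl⟩ := Submodule.Quotient.mk_surjective p y
        rw [← map_smul, Submodule.mkQ_apply, Submodule.Quotient.mk_eq_zero]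
        change ψ (r • _) ∈ W
        rw [map_smul, hψ, smul_comm]
        exact W.smul_mem _ ((hmem r).1 hr)
      refine sup_le (fun r hr => hz r (hpJ hr)) ?_
      rw [Ideal.span_singleton_le_iff_mem]
      exact hz a haJ
  exact hV.middle (Submodule.injective_subtype V) (LinearMap.exact_subtype_mkQ V)
    (Submodule.mkQ_surjective V) hquot

/-- Vanishing of cohomology above `c` passes from a finite module to all finite modules annihilated
by its annihilator. -/
theorem cechVanish_of_annihilator_le {M : Type u} [AddCommGroup M] [Module R M]
    [Module.Finite R M] {c : ℕ} (hM : ∀ n, c < n → CechVanish xs n M) {n : ℕ} (hn : c < n)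
    {N : Type u} [AddCommGroup N] [Module R N] [Module.Finite R N]
    (hN : Module.annihilator R M ≤ Module.annihilator R N) : CechVanish xs n N := by
  by_cases h : xs.length < n
  · exact cechVanish_of_length_lt h
  -- Descending induction on `n`, starting beyond the length of the Čech complex.
  obtain ⟨k, hk⟩ : ∃ k, k = xs.length + 1 - n := ⟨_, rfl⟩
  induction k generalizing n N with
  | zero => omega
  | succ k ih =>
    refine cechVanish_step (hM n hn) (fun N' _ _ _ hN' => ?_) hN
    by_cases h' : xs.length < n + 1
    · exact cechVanish_of_length_lt h'
    · exact ih (by omega) hN' h' (by omega)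

/-- The top local cohomology of a finite module with respect to `I` satisfies `Hᶜ = I Hᶜ` when
`c > 0`. -/
theorem cechSMulTop_top {M : Type u} [AddCommGroup M] [Module R M] [Module.Finite R M] {c : ℕ}
    (hM : ∀ n, c + 1 < n → CechVanish xs n M) :
    CechSMulTop xs (Ideal.span {x | x ∈ xs}) (c + 1) M := by
  intro z hz
  set I : Ideal R := Ideal.span {x | x ∈ xs} with hI
  let ι := Fin xs.length
  let g₀ : (ι → M) →ₗ[R] M := ∑ j : ι, xs.get j • LinearMap.proj j
  have hg₀ : ∀ w, g₀ w = ∑ j : ι, xs.get j • w j := fun w => by simp [g₀]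
  let D : Submodule R M := LinearMap.range g₀
  -- `D = I M`, so each generator kills the quotient outright. Its cohomology vanishes in positive
  -- degrees, which is why the degree is `c + 1`.
  have htor : powerTorsion xs (M ⧸ D) = ⊤ := by
    rw [eq_top_iff]
    intro y _ x hx
    obtain ⟨y, rfl⟩ := D.mkQ_surjective y
    refine ⟨1, ?_⟩
    rw [pow_one, ← map_smul, Submodule.mkQ_apply, Submodule.Quotient.mk_eq_zero]
    obtain ⟨j, rfl⟩ := List.get_of_mem hx
    refine ⟨Pi.single j y, ?_⟩
    rw [hg₀, Finset.sum_eq_single j]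
    · simp
    · intro b _ hb
      simp [Pi.single_eq_of_ne hb]
    · simp
  obtain ⟨a, ha, hb⟩ := cech_exact_middle (Submodule.injective_subtype D)
    (LinearMap.exact_subtype_mkQ D) (Submodule.mkQ_surjective D) hz
    (cechVanish_of_torsion htor (cechMap_mem_cocycles _ hz))
  -- A submodule of a power of `M` is annihilated by `Ann M`, so cohomology above the top degree of
  -- `M` vanishes on it.
  have hker : CechVanish xs (c + 2) (LinearMap.ker g₀.rangeRestrict) := by
    refine cechVanish_of_annihilator_le hM (by omega) (le_trans ?_
      ((LinearMap.ker _).subtype.annihilator_le_of_injective (Submodule.injective_subtype _)))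
    intro r hr
    rw [Module.mem_annihilator] at hr ⊢
    exact fun w => funext fun j => hr (w j)
  obtain ⟨w, hw, rfl⟩ := cech_lift_cocycle_of_ker g₀.surjective_rangeRestrict hker ha
  rw [← LinearMap.comp_apply, ← cechMap_comp, LinearMap.subtype_comp_codRestrict] at hb
  have hsum : cechMap g₀ xs (c + 2) w =
      ∑ j : ι, xs.get j • cechMap (LinearMap.proj j) xs (c + 2) w := by
    change cechMapₗ _ _ xs (c + 2) g₀ w = ∑ j : ι, xs.get j • cechMapₗ _ _ xs (c + 2) _ w
    simp [g₀, LinearMap.sum_apply]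
  refine Submodule.mem_sup.2 ⟨_, ?_, _, hb, add_sub_cancel _ _⟩
  rw [hsum]
  refine sum_mem fun j _ => Submodule.smul_mem_smul (Ideal.subset_span (List.get_mem xs j)) ?_
  exact cechMap_mem_cocycles _ hw

end CohomologicalDimension

/-! ### Torsion in injective modules and Čech acyclicity. -/

section Injective

variable {R : Type u} [CommRing R]

/-- A finitely generated ideal contained in the radical of the annihilator of `a` has a power inside
that annihilator. -/
theorem mem_powerTorsion_iff {xs : List R} {N : Type u} [AddCommGroup N] [Module R N] {a : N} :
    a ∈ powerTorsion xs N ↔ ∃ k, ∀ r ∈ Ideal.span {x | x ∈ xs} ^ k, r • a = 0 := by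
  constructor
  · intro h
    have hrad : Ideal.span {x | x ∈ xs} ≤
        Ideal.radical (LinearMap.ker (LinearMap.toSpanSingleton R N a)) := by
      rw [Ideal.span_le]
      intro x hx
      obtain ⟨k, hk⟩ := h x hx
      exact ⟨k, hk⟩
    obtain ⟨k, hk⟩ := Ideal.exists_pow_le_of_le_radical_of_fg hrad
      (Submodule.fg_span (List.finite_toSet xs))
    exact ⟨k, fun r hr => hk hr⟩
  · rintro ⟨k, hk⟩ x hx
    exact ⟨k, hk _ (Ideal.pow_mem_pow (Ideal.subset_span (s := {x | x ∈ xs}) hx) k)⟩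

/-- Torsion elements of an injective module over a Noetherian ring can be divided by powers of a
ring element, up to torsion with respect to that element. -/
theorem exists_torsion_division [IsNoetherianRing R] {C : Type u} [AddCommGroup C] [Module R C]
    (hC : Module.Injective R C) {xs : List R} {c : C} (hc : c ∈ powerTorsion xs C) (x : R)
    (k : ℕ) : ∃ c' ∈ powerTorsion xs C, ∃ l, x ^ (k + l) • c' = x ^ l • c := by
  obtain ⟨m, hm⟩ := mem_powerTorsion_iff.1 hc
  set J : Ideal R := Ideal.span {x | x ∈ xs} with hJ
  -- the annihilators of the powers of `x` stabilize
  let ann : ℕ →o Ideal R :=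
    ⟨fun l => LinearMap.ker (LinearMap.lsmul R R (x ^ l)), monotone_nat_of_le_succ fun l r hr => by
      rw [LinearMap.mem_ker, LinearMap.lsmul_apply, smul_eq_mul] at hr ⊢
      rw [pow_succ', mul_assoc, hr, mul_zero]⟩
  obtain ⟨l, hl⟩ := monotone_stabilizes_iff_noetherian.2
    (inferInstanceAs (IsNoetherian R R)) ann
  have hl' : ∀ r, x ^ (k + l) * r = 0 → x ^ l * r = 0 := by
    intro r hr
    have h1 : r ∈ ann (k + l) := hr
    rw [← hl (k + l) (by omega)] at h1
    exact h1
  -- Artin–Rees. Together with the stabilized annihilators it makes the assignment `x ^ (k + l) r ↦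
  -- r x ^ l c` well defined on a submodule of `R ⧸ J ^ (m + q)`. Injectivity of `C` extends it, and
  -- `c'` is the image of `1`.
  obtain ⟨q, hq⟩ := Ideal.exists_pow_inf_eq_pow_smul J (M := R) (Ideal.span {x ^ (k + l)})
  have hAR : ∀ r, x ^ (k + l) * r ∈ J ^ (m + q) →
      ∃ j ∈ J ^ m, x ^ (k + l) * r = x ^ (k + l) * j := by
    intro r hr
    have h1 : x ^ (k + l) * r ∈ J ^ (m + q) • (⊤ : Ideal R) ⊓ Ideal.span {x ^ (k + l)} :=
      ⟨by simpa using hr, Ideal.mul_mem_right _ _ (Ideal.mem_span_singleton_self _)⟩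
    rw [hq (m + q) (by omega), Nat.add_sub_cancel] at h1
    have h2 := smul_mono_right (J ^ m) (inf_le_right : J ^ q • (⊤ : Ideal R) ⊓
      Ideal.span {x ^ (k + l)} ≤ _) h1
    rw [smul_eq_mul, Ideal.mem_mul_span_singleton] at h2
    obtain ⟨j, hj, hjr⟩ := h2
    exact ⟨j, hj, by rw [← hjr, mul_comm]⟩
  let φ : R →ₗ[R] R ⧸ J ^ (m + q) := (J ^ (m + q)).mkQ ∘ₗ LinearMap.lsmul R R (x ^ (k + l))
  let θ : R →ₗ[R] C := LinearMap.toSpanSingleton R C (x ^ l • c)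
  have hker : LinearMap.ker φ ≤ LinearMap.ker θ := by
    intro r hr
    have h1 : x ^ (k + l) * r ∈ J ^ (m + q) := (Submodule.Quotient.mk_eq_zero _).1 hr
    obtain ⟨j, hj, hjr⟩ := hAR r h1
    have h2 := hl' (r - j) (by rw [mul_sub, hjr, sub_self])
    rw [mul_sub, sub_eq_zero] at h2
    rw [LinearMap.mem_ker, LinearMap.toSpanSingleton_apply, ← mul_smul, mul_comm, h2, mul_smul,
      hm j hj, smul_zero]
  obtain ⟨h, hh⟩ := hC.out ((LinearMap.ker φ).liftQ φ le_rfl)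
    (LinearMap.ker_eq_bot.1 (Submodule.ker_liftQ_eq_bot _ _ _ le_rfl))
    ((LinearMap.ker φ).liftQ θ hker)
  have hφ : ∀ r, h (φ r) = θ r := fun r => hh (Submodule.Quotient.mk r)
  refine ⟨h (Submodule.Quotient.mk 1), mem_powerTorsion_iff.2 ⟨m + q, fun r hr => ?_⟩, l, ?_⟩
  · have h0 : r • (Submodule.Quotient.mk 1 : R ⧸ J ^ (m + q)) = 0 := by
      rw [← Submodule.Quotient.mk_smul, Submodule.Quotient.mk_eq_zero, smul_eq_mul, mul_one]
      exact hr
    rw [← map_smul, h0, map_zero]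
  · have h1 := hφ 1
    rw [LinearMap.toSpanSingleton_apply, one_smul] at h1
    rw [← map_smul, ← Submodule.Quotient.mk_smul, ← h1]
    rfl

/-- If the degree zero cohomology of the Čech complex surjects onto its localization at `x`, then
vanishing of the higher cohomology is inherited on adding `x` to the list. -/
theorem cechVanish_cons {N : Type u} [AddCommGroup N] [Module R N] (x : R) (xs : List R)
    (h : ∀ n, CechVanish xs (n + 1) N)
    (hdiv : ∀ a ∈ powerTorsion xs N, ∀ k, ∃ a' ∈ powerTorsion xs N, ∃ l : ℕ,
      x ^ (k + l) • a' = x ^ l • a) (n : ℕ) : CechVanish (x :: xs) (n + 1) N := by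
  rintro ⟨a, b⟩ hab
  have hab' : coneD x (cech N xs) (n + 1) (a, b) = (0, 0) := hab
  rw [coneD_apply, Prod.mk.injEq, sub_eq_zero] at hab'
  obtain ⟨ha, hb⟩ := hab'
  obtain ⟨a', rfl⟩ := h n ha
  have hker : awayMap x ((cech N xs).d (n + 1)) (toAway x _ a' - b) = 0 := by
    rw [map_sub, awayMap_toAway, hb, sub_self]
  -- The preimage `a'` may be altered by a cocycle `e`, so the localized cocycle `a' - b` only has
  -- to be a boundary modulo images of unlocalized cocycles.
  suffices hs : ∃ e, (cech N xs).d (n + 1) e = 0 ∧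
      ∃ b' : Away x ((cech N xs).X n),
        toAway x _ a' - b = toAway x _ e + awayMap x ((cech N xs).d n) b' by
    obtain ⟨e, he, b', hb'⟩ := hs
    refine ⟨((a' - e, b') : (cech N xs).X (n + 1) × Away x ((cech N xs).X n)), ?_⟩
    change coneD x (cech N xs) n (a' - e, b') = (_, b)
    rw [coneD_apply, map_sub, he, sub_zero, map_sub, sub_sub, ← hb', sub_sub_cancel]
  match n with
  | 0 =>
    -- In the lowest degree there are no boundaries. After clearing denominators the element comes
    -- from a torsion element `w`, and `hdiv` divides it back by `x ^ (k + j)`.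
    obtain ⟨k, z, hz⟩ := exists_pow_smul_eq_toAway x (toAway x _ a' - b)
    have hdz : toAway x _ ((cech N xs).d 1 z) = 0 := by
      rw [← awayMap_toAway, ← hz, map_smul, hker, smul_zero]
    obtain ⟨j, hj⟩ := (toAway_eq_zero x _).1 hdz
    obtain ⟨w, hw⟩ := (cechAug_bijective xs).2 (x ^ j • z)
    have hwt : w ∈ powerTorsion xs N := by
      rw [← cech_d_aug_eq_zero, hw, map_smul, hj]
    obtain ⟨w', hw', l, hl⟩ := hdiv w hwt (k + j)
    refine ⟨cechAug N xs w', (cech_d_aug_eq_zero xs w').2 hw', 0, ?_⟩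
    rw [map_zero, add_zero]
    apply away_pow_smul_injective x (k + j + l)
    rw [← map_smul, ← map_smul, hl, map_smul, hw, map_smul, map_smul, ← hz,
      show k + j + l = l + (j + k) by omega, pow_add, pow_add, mul_smul, mul_smul]
  | n + 1 =>
    have hex : Function.Exact ((cech N xs).d (n + 1)) ((cech N xs).d (n + 2)) := fun y =>
      ⟨fun hy => h n hy, by rintro ⟨y, rfl⟩; exact (cech N xs).d_d _ _⟩
    obtain ⟨b', hb'⟩ := (awayMap_exact x _ _ hex _).1 hker
    exact ⟨0, map_zero _, b', by rw [map_zero, zero_add, hb']⟩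

end Injective

/-! ### Homogeneous components, and acyclicity of the graded hulls. -/

namespace GrModule

variable {R : Type u} [CommRing R] {𝒜 : ℕ → AddSubgroup R}

theorem proj_mem (N : GrModule 𝒜) (n : ℤ) (x : N) : N.proj n x ∈ N.piece n := by
  obtain ⟨b, rfl⟩ := N.isInternal.2 x
  rw [proj_coe]
  exact (b n).2

theorem proj_smul (N : GrModule 𝒜) {i : ℕ} {r : R} (hr : r ∈ 𝒜 i) (n : ℤ) (x : N) :
    N.proj (i + n) (r • x) = r • N.proj n x := by
  induction x using N.induction_piece with
  | h0 => simp
  | hadd x y hx hy => rw [smul_add, map_add, map_add, smul_add, hx, hy]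
  | h m x hx =>
    by_cases hmn : n = m
    · subst hmn
      rw [N.proj_same _ _ hx, N.proj_same _ _ (N.smul_mem' i n r x hr hx)]
    · rw [N.proj_ne _ _ _ hx hmn, N.proj_ne _ _ _ (N.smul_mem' i m r x hr hx) (by omega),
        smul_zero]

/-- An element of a graded module is the finite sum of its homogeneous components. -/
theorem exists_sum_proj (N : GrModule 𝒜) (x : N) :
    ∃ s : Finset ℤ, (∀ n, n ∉ s → N.proj n x = 0) ∧ ∑ n ∈ s, N.proj n x = x := by
  classical
  obtain ⟨b, rfl⟩ := N.isInternal.2 x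
  refine ⟨DFinsupp.support b, fun n hn => ?_, ?_⟩
  · rw [proj_coe, DFinsupp.notMem_support_iff.1 hn]
    rfl
  · simp only [proj_coe]
    exact (DirectSum.coeAddMonoidHom_eq_dfinsuppSum _ b).symm

theorem mem_of_forall_proj_mem (N : GrModule 𝒜) (L : AddSubgroup N) {x : N}
    (h : ∀ n, N.proj n x ∈ L) : x ∈ L := by
  obtain ⟨s, -, hs⟩ := N.exists_sum_proj x
  rw [← hs]
  exact sum_mem fun n _ => h n

theorem proj_mem_powerTorsion [GradedRing 𝒜] (N : GrModule 𝒜) {xs : List R}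
    (hxs : ∀ x ∈ xs, x ∈ 𝒜 1) {a : N} (ha : a ∈ powerTorsion xs N) (n : ℤ) :
    N.proj n a ∈ powerTorsion xs N := by
  intro x hx
  obtain ⟨k, hk⟩ := ha x hx
  refine ⟨k, ?_⟩
  rw [← N.proj_smul (SetLike.pow_mem_graded k (hxs x hx)), hk, map_zero]

theorem mem_powerTorsion_iff_proj [GradedRing 𝒜] (N : GrModule 𝒜) {xs : List R}
    (hxs : ∀ x ∈ xs, x ∈ 𝒜 1) {a : N} :
    a ∈ powerTorsion xs N ↔ ∀ n, N.proj n a ∈ powerTorsion xs N :=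
  ⟨fun h => N.proj_mem_powerTorsion hxs h,
    N.mem_of_forall_proj_mem (powerTorsion xs N).toAddSubgroup⟩

theorem cofreeMono_injective [GradedRing 𝒜] {C : Type u} [AddCommGroup C] [Module R C] (n : ℤ) :
    Function.Injective (cofreeMono (𝒜 := 𝒜) (C := C) n) :=
  Finsupp.single_injective n

theorem cofreeMono_mem_powerTorsion [GradedRing 𝒜] {C : Type u} [AddCommGroup C] [Module R C]
    {xs : List R} (hxs : ∀ x ∈ xs, x ∈ 𝒜 1) (n : ℤ) (c : C) :
    cofreeMono (𝒜 := 𝒜) n c ∈ powerTorsion xs (cofree (𝒜 := 𝒜) C) ↔ c ∈ powerTorsion xs C := by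
  rw [mem_powerTorsion, mem_powerTorsion]
  refine forall₂_congr fun x hx => exists_congr fun k => ?_
  rw [cofree_smul_mono C _ _ (SetLike.pow_mem_graded k (hxs x hx)),
    map_eq_zero_iff _ (cofreeMono_injective _)]

/-- Elements admitting such a division form a subgroup, which reduces the claim to monomials `c Tⁿ`,
where it is the division property of `C`. -/
theorem exists_torsion_division_cofree [GradedRing 𝒜] [IsNoetherianRing R] {C : Type u}
    [AddCommGroup C] [Module R C] (hC : Module.Injective R C) {xs : List R}
    (hxs : ∀ x ∈ xs, x ∈ 𝒜 1) {x : R} (hx : x ∈ 𝒜 1) (k : ℕ) {a : cofree (𝒜 := 𝒜) C}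
    (ha : a ∈ powerTorsion xs (cofree (𝒜 := 𝒜) C)) :
    ∃ a' ∈ powerTorsion xs (cofree (𝒜 := 𝒜) C), ∃ l : ℕ, x ^ (k + l) • a' = x ^ l • a := by
  let L : AddSubgroup (cofree (𝒜 := 𝒜) C) :=
    { carrier := {a | ∃ a' ∈ powerTorsion xs (cofree (𝒜 := 𝒜) C), ∃ l : ℕ,
        x ^ (k + l) • a' = x ^ l • a}
      zero_mem' := ⟨0, zero_mem _, 0, by simp⟩
      add_mem' := by
        rintro a b ⟨a', ha', l, hl⟩ ⟨b', hb', m, hm⟩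
        refine ⟨a' + b', add_mem ha' hb', l + m, ?_⟩
        have h1 : x ^ (k + (l + m)) • a' = x ^ (l + m) • a := by
          rw [show k + (l + m) = m + (k + l) by omega, pow_add, mul_smul, hl, ← mul_smul,
            ← pow_add, add_comm m l]
        have h2 : x ^ (k + (l + m)) • b' = x ^ (l + m) • b := by
          rw [show k + (l + m) = l + (k + m) by omega, pow_add, mul_smul, hm, ← mul_smul,
            ← pow_add]
        rw [smul_add, smul_add, h1, h2]
      neg_mem' := by
        rintro a ⟨a', ha', l, hl⟩
        exact ⟨-a', neg_mem ha', l, by rw [smul_neg, smul_neg, hl]⟩ }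
  refine mem_of_forall_proj_mem _ L fun n => ?_
  obtain ⟨c, hc⟩ := (cofree (𝒜 := 𝒜) C).proj_mem n a
  have hc' : cofreeMono (𝒜 := 𝒜) n c = (cofree (𝒜 := 𝒜) C).proj n a := hc
  have hct : c ∈ powerTorsion xs C := by
    rw [← cofreeMono_mem_powerTorsion hxs n, hc']
    exact proj_mem_powerTorsion _ hxs ha n
  obtain ⟨c', hct', l, hl⟩ := exists_torsion_division hC hct x k
  -- The degree `n - k` compensates for the extra factor `xᵏ`, as `x` has degree one.
  refine ⟨cofreeMono (n - k) c', (cofreeMono_mem_powerTorsion hxs _ _).2 hct', l, ?_⟩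
  rw [← hc', cofree_smul_mono C _ _ (SetLike.pow_mem_graded _ hx),
    cofree_smul_mono C _ _ (SetLike.pow_mem_graded _ hx), hl]
  refine congrArg (fun j => cofreeMono j (x ^ l • c)) ?_
  simp only [smul_eq_mul, mul_one]
  push_cast
  ring

/-- The Čech cohomology of a cofree graded module on an injective module vanishes in positive
degrees. -/
theorem cechVanish_cofree [GradedRing 𝒜] [IsNoetherianRing R] {C : Type u} [AddCommGroup C]
    [Module R C] (hC : Module.Injective R C) {xs : List R} (hxs : ∀ x ∈ xs, x ∈ 𝒜 1) (n : ℕ) :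
    CechVanish xs (n + 1) (cofree (𝒜 := 𝒜) C) := by
  induction xs generalizing n with
  | nil => exact cechVanish_of_length_lt (by simp)
  | cons x xs ih =>
    have hxs' : ∀ y ∈ xs, y ∈ 𝒜 1 := fun y hy => hxs y (List.mem_cons_of_mem _ hy)
    exact cechVanish_cons x xs (ih hxs') (fun a ha k =>
      exists_torsion_division_cofree hC hxs' (hxs x List.mem_cons_self) k ha) n

theorem cechVanish_hull [GradedRing 𝒜] [IsNoetherianRing R] (M : GrModule 𝒜) {xs : List R}
    (hxs : ∀ x ∈ xs, x ∈ 𝒜 1) (n : ℕ) : CechVanish xs (n + 1) M.hull :=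
  cechVanish_cofree (Module.injective_module_of_injective_object
    (inj := inferInstanceAs (CategoryTheory.Injective
      (CategoryTheory.Injective.under (ModuleCat.of R M))))) hxs n

end GrModule

/-! ### Monomials and generators in a standard graded ring. -/

section StandardGraded

open scoped Pointwise

variable {R : Type u} [CommRing R] {𝒜 : ℕ → AddSubgroup R} [GradedRing 𝒜]

theorem IsStandardGraded.isNoetherianRing (h : IsStandardGraded 𝒜) : IsNoetherianRing R := by
  obtain ⟨h0, s, -, hs⟩ := h
  have : Algebra.FiniteType (baseRing 𝒜) R := ⟨⟨s, hs⟩⟩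
  exact Algebra.FiniteType.isNoetherianRing (baseRing 𝒜) R

theorem IsStandardGraded.exists_list (h : IsStandardGraded 𝒜) :
    ∃ xs : List R, (∀ x ∈ xs, x ∈ 𝒜 1) ∧ Algebra.adjoin (baseRing 𝒜) {x | x ∈ xs} = ⊤ := by
  obtain ⟨-, s, hs1, hs⟩ := h
  refine ⟨s.toList, fun x hx => hs1 (by simpa using hx), ?_⟩
  rw [← hs]
  congr 1
  ext x
  simp

theorem decompose_baseRing_smul (a : baseRing 𝒜) (r : R) (n : ℕ) :
    (DirectSum.decompose 𝒜 (a • r) n : R) = a • (DirectSum.decompose 𝒜 r n : R) :=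
  DirectSum.coe_decompose_mul_of_left_mem_zero 𝒜 a.2

theorem pow_subset_of_subset_one {s : Set R} (hs : s ⊆ 𝒜 1) (n : ℕ) : s ^ n ⊆ 𝒜 n := by
  induction n with
  | zero =>
    rw [pow_zero, Set.one_subset]
    exact SetLike.one_mem_graded 𝒜
  | succ n ih =>
    rw [pow_succ]
    rintro _ ⟨a, ha, b, hb, rfl⟩
    exact SetLike.mul_mem_graded (ih ha) (hs hb)

theorem finite_pow {s : Set R} (hs : s.Finite) (n : ℕ) : (s ^ n).Finite := by
  induction n with
  | zero => exact Set.finite_one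
  | succ n ih =>
    rw [pow_succ]
    exact ih.mul hs

theorem exists_mem_pow_of_mem_closure {s : Set R} {r : R} (hr : r ∈ Submonoid.closure s) :
    ∃ n : ℕ, r ∈ s ^ n := by
  induction hr using Submonoid.closure_induction with
  | mem x hx => exact ⟨1, by rwa [pow_one]⟩
  | one => exact ⟨0, by rw [pow_zero]; exact Set.one_mem_one⟩
  | mul x y _ _ hx hy =>
    obtain ⟨n, hn⟩ := hx
    obtain ⟨m, hm⟩ := hy
    exact ⟨n + m, by rw [pow_add]; exact Set.mul_mem_mul hn hm⟩

/-- In a standard graded ring, `Rₙ` is spanned over `R₀` by the monomials of degree `n`. -/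
theorem decompose_mem_span_pow {s : Set R} (hs : s ⊆ 𝒜 1)
    (hadj : Algebra.adjoin (baseRing 𝒜) s = ⊤) (r : R) (n : ℕ) :
    (DirectSum.decompose 𝒜 r n : R) ∈ Submodule.span (baseRing 𝒜) (s ^ n) := by
  have hr : r ∈ Submodule.span (baseRing 𝒜) (Submonoid.closure s : Set R) := by
    rw [← Algebra.adjoin_eq_span, hadj]
    trivial
  induction hr using Submodule.span_induction with
  | mem x hx =>
    obtain ⟨m, hm⟩ := exists_mem_pow_of_mem_closure hx
    by_cases hmn : m = n
    · subst hmn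
      rw [DirectSum.decompose_of_mem_same 𝒜 (pow_subset_of_subset_one hs m hm)]
      exact Submodule.subset_span hm
    · rw [DirectSum.decompose_of_mem_ne 𝒜 (pow_subset_of_subset_one hs m hm) hmn]
      exact zero_mem _
  | zero => simp
  | add x y _ _ hx hy =>
    rw [DirectSum.decompose_add, DirectSum.add_apply]
    exact add_mem hx hy
  | smul a x _ hx =>
    rw [decompose_baseRing_smul]
    exact Submodule.smul_mem _ a hx

/-- `𝔪₀` lives in degree zero, so taking components commutes with its action. This keeps the error
term in the form that Nakayama requires. -/
theorem decompose_mem_maxIdeal_smul [IsLocalRing (baseRing 𝒜)] {s : Set R} (hs : s ⊆ 𝒜 1)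
    (hadj : Algebra.adjoin (baseRing 𝒜) s = ⊤) {r : R} (hr : r ∈ maxIdealExt 𝒜) (n : ℕ) :
    (DirectSum.decompose 𝒜 r n : R) ∈ IsLocalRing.maximalIdeal (baseRing 𝒜) •
      Submodule.span (baseRing 𝒜) (s ^ n) := by
  obtain ⟨k, f, g, rfl⟩ := Submodule.mem_span_set'.1 hr
  rw [DirectSum.decompose_sum, DFinsupp.finsetSum_apply, AddSubgroup.val_finsetSum]
  refine sum_mem fun i _ => ?_
  obtain ⟨a, ha, hag⟩ := (g i).2
  have h : f i • (g i : R) = a • f i := by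
    rw [← hag, smul_eq_mul, mul_comm]
    rfl
  rw [h, decompose_baseRing_smul]
  exact Submodule.smul_mem_smul ha (decompose_mem_span_pow hs hadj _ n)

theorem irrelevantIdeal_eq_span {s : Set R} (hs : s ⊆ 𝒜 1)
    (hadj : Algebra.adjoin (baseRing 𝒜) s = ⊤) : irrelevantIdeal 𝒜 = Ideal.span s := by
  apply le_antisymm
  · intro r hr
    have h0 : (DirectSum.decompose 𝒜 r 0 : R) = 0 := (HomogeneousIdeal.mem_irrelevant_iff 𝒜 r).1 hr
    classical
    rw [← DirectSum.sum_support_decompose 𝒜 r]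
    refine sum_mem fun n _ => ?_
    match n with
    | 0 => rw [h0]; exact zero_mem _
    | n + 1 =>
      have h1 : Submodule.span (baseRing 𝒜) (s ^ (n + 1)) ≤
          (Ideal.span s).restrictScalars (baseRing 𝒜) := by
        rw [Submodule.span_le, pow_succ]
        rintro _ ⟨a, -, b, hb, rfl⟩
        exact Ideal.mul_mem_left _ a (Ideal.subset_span hb)
      exact h1 (decompose_mem_span_pow hs hadj r (n + 1))
  · rw [Ideal.span_le]
    intro x hx
    refine (HomogeneousIdeal.mem_irrelevant_iff 𝒜 x).2 ?_
    exact DirectSum.decompose_of_mem_ne 𝒜 (hs hx) one_ne_zero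

end StandardGraded

/-! ### Pair torsion equals `R₊`-torsion on graded modules. -/

namespace GrModule

open scoped Pointwise

variable {R : Type u} [CommRing R] {𝒜 : ℕ → AddSubgroup R}

/-- The degrees of the components of an element that are not torsion. -/
def nontorsionDegrees (N : GrModule 𝒜) (xs : List R) (y : N) : Set ℤ :=
  {m | N.proj m y ∉ powerTorsion xs N}

theorem nontorsionDegrees_finite (N : GrModule 𝒜) (xs : List R) (y : N) :
    (N.nontorsionDegrees xs y).Finite := by
  obtain ⟨s, hs, -⟩ := N.exists_sum_proj y
  refine s.finite_toSet.subset fun m hm => ?_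
  by_contra h
  exact hm (by rw [hs m h]; exact zero_mem _)

/-- A homogeneous scalar only shifts degrees, so no new nontorsion component appears while the one
at `m` is lost. This is the decrease that drives the induction in `mem_pairTorsion_iff`. -/
theorem nontorsionDegrees_smul (N : GrModule 𝒜) (xs : List R) {i : ℕ} {r : R} (hr : r ∈ 𝒜 i)
    {y : N} {m : ℤ} (hm : m ∈ N.nontorsionDegrees xs y)
    (hrm : r • N.proj m y ∈ powerTorsion xs N) :
    (N.nontorsionDegrees xs (r • y)).ncard < (N.nontorsionDegrees xs y).ncard := by
  have hfin := N.nontorsionDegrees_finite xs y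
  have hsub : N.nontorsionDegrees xs (r • y) ⊆
      (fun a => (i : ℤ) + a) '' (N.nontorsionDegrees xs y \ {m}) := by
    intro n hn
    have hn' : r • N.proj (n - i) y ∉ powerTorsion xs N := by
      rw [← N.proj_smul hr, add_sub_cancel]
      exact hn
    refine ⟨n - i, ⟨fun h => hn' (Submodule.smul_mem _ r h), ?_⟩, add_sub_cancel _ _⟩
    rintro rfl
    exact hn' hrm
  calc _ ≤ _ := Set.ncard_le_ncard hsub (hfin.sdiff.image _)
    _ ≤ _ := Set.ncard_image_le hfin.sdiff
    _ < _ := Set.ncard_sdiff_singleton_lt_of_mem hm hfin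

variable [GradedRing 𝒜]

/-- If homogeneous elements killing one nontorsion component of `y` modulo torsion kill all of `y`
modulo torsion, then the annihilator of `y` modulo torsion is homogeneous. -/
theorem decompose_smul_mem_powerTorsion (N : GrModule 𝒜) {xs : List R}
    (hxs : ∀ x ∈ xs, x ∈ 𝒜 1) {y : N}
    (hy : ∀ (i : ℕ) (r : R), r ∈ 𝒜 i → ∀ m ∈ N.nontorsionDegrees xs y,
      r • N.proj m y ∈ powerTorsion xs N → r • y ∈ powerTorsion xs N)
    {r : R} (hr : r • y ∈ powerTorsion xs N) (j : ℕ) :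
    (DirectSum.decompose 𝒜 r j : R) • y ∈ powerTorsion xs N := by
  classical
  rcases (N.nontorsionDegrees xs y).eq_empty_or_nonempty with hempty | hne
  · refine Submodule.smul_mem _ _ ((N.mem_powerTorsion_iff_proj hxs).2 fun n => ?_)
    by_contra h
    exact (hempty ▸ (h : n ∈ N.nontorsionDegrees xs y) : n ∈ (∅ : Set ℤ))
  -- In degree `j + m` of `r y`, the terms with `i < j` are torsion by induction and those with `i >
  -- j` by minimality of `m`. Only `rⱼ yₘ` is left.
  obtain ⟨m, hm, hmin⟩ := (N.nontorsionDegrees_finite xs y).exists_minimal hne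
  induction j using Nat.strong_induction_on with
  | _ j ih =>
  by_cases hj : j ∈ DFinsupp.support (DirectSum.decompose 𝒜 r)
  swap
  · rw [DFinsupp.notMem_support_iff.1 hj]
    simp
  refine hy j _ (DirectSum.decompose 𝒜 r j).2 m hm ?_
  have h1 := N.proj_mem_powerTorsion hxs hr (j + m)
  have h2 : ∀ i : ℕ, N.proj (j + m) ((DirectSum.decompose 𝒜 r i : R) • y) =
      (DirectSum.decompose 𝒜 r i : R) • N.proj (j + m - i) y := fun i => by
    rw [← N.proj_smul (DirectSum.decompose 𝒜 r i).2, add_sub_cancel]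
  nth_rw 1 [← DirectSum.sum_support_decompose 𝒜 r] at h1
  rw [Finset.sum_smul, map_sum, ← Finset.add_sum_erase _ _ hj, Submodule.add_mem_iff_left] at h1
  · rwa [h2, add_sub_cancel_left] at h1
  · refine sum_mem fun i hi => ?_
    have hij := Finset.ne_of_mem_erase hi
    rcases lt_or_gt_of_ne hij with hij | hij
    · exact N.proj_mem_powerTorsion hxs (ih i hij) _
    · rw [h2]
      refine Submodule.smul_mem _ _ ?_
      by_contra hcon
      have := hmin hcon (by omega)
      omega

/-- On graded modules over a standard graded ring with local base ring, the torsion functor of the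
pair `(R₊, 𝔪₀R)` agrees with the `R₊`-torsion functor. -/
theorem mem_pairTorsion_iff [IsLocalRing (baseRing 𝒜)] (N : GrModule 𝒜) {xs : List R}
    (hxs : ∀ x ∈ xs, x ∈ 𝒜 1) (hadj : Algebra.adjoin (baseRing 𝒜) {x | x ∈ xs} = ⊤) (y : N) :
    y ∈ pairTorsion (irrelevantIdeal 𝒜) (maxIdealExt 𝒜) N ↔ y ∈ powerTorsion xs N := by
  have hI := irrelevantIdeal_eq_span (𝒜 := 𝒜) (s := {x | x ∈ xs}) hxs hadj
  constructor
  swap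
  · intro hy
    obtain ⟨k, hk⟩ := mem_powerTorsion_iff.1 hy
    refine ⟨k, fun n hn => ?_⟩
    rw [Submodule.smul_le]
    intro r hr z hz
    obtain ⟨t, rfl⟩ := Submodule.mem_span_singleton.1 hz
    rw [hI] at hr
    rw [smul_comm, hk r (Ideal.pow_le_pow_right hn hr), smul_zero]
    exact zero_mem _
  rintro ⟨k, hk⟩
  have hky : ∀ r ∈ irrelevantIdeal 𝒜 ^ k, ∃ v ∈ maxIdealExt 𝒜, v • y = r • y := fun r hr =>
    Submodule.mem_smul_span_singleton.1
      (hk k le_rfl (Submodule.smul_mem_smul hr (Submodule.mem_span_singleton_self y)))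
  clear hk
  obtain ⟨d, hd⟩ : ∃ d, d = (N.nontorsionDegrees xs y).ncard := ⟨_, rfl⟩
  induction d using Nat.strong_induction_on generalizing y with
  | _ d ih =>
  subst hd
  -- The relation `R₊ᵏ y ⊆ 𝔪₀R y` is inherited by `r y`, which has fewer nontorsion components, so
  -- the induction hypothesis applies to it.
  have hhom : ∀ (i : ℕ) (r : R), r ∈ 𝒜 i → ∀ m ∈ N.nontorsionDegrees xs y,
      r • N.proj m y ∈ powerTorsion xs N → r • y ∈ powerTorsion xs N := by
    intro i r hr m hm hrm
    refine ih _ (N.nontorsionDegrees_smul xs hr hm hrm) (r • y) (fun t ht => ?_) rfl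
    obtain ⟨v, hv, hvt⟩ := hky t ht
    exact ⟨v, hv, by rw [smul_comm, hvt, smul_comm]⟩
  let Q : Ideal R := (powerTorsion xs N).comap (LinearMap.toSpanSingleton R N y)
  have hQ : ∀ r, r ∈ Q ↔ r • y ∈ powerTorsion xs N := fun r => Iff.rfl
  let W : Submodule (baseRing 𝒜) R := Submodule.span (baseRing 𝒜) ({x | x ∈ xs} ^ k)
  have hWfg : W.FG := Submodule.fg_span (finite_pow (List.finite_toSet xs) k)
  have hpow : irrelevantIdeal 𝒜 ^ k = Ideal.span ({x | x ∈ xs} ^ k) := by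
    rw [hI, Ideal.span, Submodule.span_pow]
  have hW : W ≤ Q.restrictScalars (baseRing 𝒜) ⊔ IsLocalRing.maximalIdeal (baseRing 𝒜) • W := by
    rw [Submodule.span_le]
    intro t ht
    obtain ⟨v, hv, hvt⟩ := hky t (hpow ▸ Ideal.subset_span ht)
    have h1 : (t - v) • y ∈ powerTorsion xs N := by
      rw [sub_smul, hvt, sub_self]
      exact zero_mem _
    have h2 := N.decompose_smul_mem_powerTorsion hxs hhom h1 k
    rw [DirectSum.decompose_sub, DirectSum.sub_apply, AddSubgroup.coe_sub,
      DirectSum.decompose_of_mem_same 𝒜 (pow_subset_of_subset_one hxs k ht)] at h2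
    exact Submodule.mem_sup.2 ⟨_, (hQ _).2 h2, _, decompose_mem_maxIdeal_smul hxs hadj hv k,
      sub_add_cancel _ _⟩
  -- Nakayama for the finite `R₀`-module spanned by the monomials of degree `k`.
  have hWQ := Submodule.le_of_le_smul_of_le_jacobson_bot hWfg
    (IsLocalRing.maximalIdeal_le_jacobson ⊥) hW
  intro x hx
  obtain ⟨l, hl⟩ := (hQ (x ^ k)).1 (hWQ (Submodule.subset_span (Set.pow_mem_pow hx))) x hx
  exact ⟨l + k, by rw [pow_add, mul_smul, hl]⟩

end GrModule

/-! ### Derived functors of pair torsion versus Čech cohomology. -/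

namespace GrModule

variable {R : Type u} [CommRing R] {𝒜 : ℕ → AddSubgroup R}

theorem subsingleton_cohomology_iff {M : GrModule 𝒜} (P : StarInjectiveResolution M)
    (I J : Ideal R) (i : ℕ) :
    Subsingleton (P.cohomology I J i) ↔ P.cocycles I J i ≤ P.coboundaries I J i := by
  rw [Submodule.Quotient.subsingleton_iff, Submodule.comap_subtype_eq_top]

variable [GradedRing 𝒜]

theorem exact_toHull_cosyzygyProj (M : GrModule 𝒜) (i : ℕ) :
    Function.Exact (M.cosyzygy i).toHull (M.cosyzygyProj i) :=
  M.cosyzygyProj_eq_zero i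

/-- Dimension shifting along the cosyzygies. -/
theorem cechSMulTop_cosyzygy [IsNoetherianRing R] (M : GrModule 𝒜) {xs : List R}
    (hxs : ∀ x ∈ xs, x ∈ 𝒜 1) (K : Ideal R) (i n : ℕ) :
    CechSMulTop xs K (n + 1 + i) M ↔ CechSMulTop xs K (n + 1) (M.cosyzygy i) := by
  induction i generalizing n with
  | zero => rfl
  | succ i ih =>
    rw [show n + 1 + (i + 1) = n + 1 + 1 + i by omega, ih (n + 1)]
    exact cechSMulTop_shift (toHull_injective _) (M.exact_toHull_cosyzygyProj i)
      (M.cosyzygyProj_surjective i) (cechVanish_hull _ hxs _) (cechVanish_hull _ hxs _) K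

/-- A finite graded module over an `ℕ`-graded ring is bounded below. -/
theorem exists_proj_eq_zero (M : GrModule 𝒜) [hM : Module.Finite R M] :
    ∃ n₀ : ℤ, ∀ n ≤ n₀, ∀ x, M.proj n x = 0 := by
  classical
  obtain ⟨S, hS⟩ := hM.fg_top
  have hbound : ∀ x : M, ∃ n₀ : ℤ, ∀ n ≤ n₀, M.proj n x = 0 := by
    intro x
    obtain ⟨s, hs, -⟩ := M.exists_sum_proj x
    obtain ⟨m, hm⟩ := s.finite_toSet.bddBelow
    exact ⟨m - 1, fun n hn => hs n fun hns => by have := hm (Finset.mem_coe.2 hns); omega⟩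
  choose b hb using hbound
  obtain ⟨n₀, hn₀⟩ := (S.image b).finite_toSet.bddBelow
  refine ⟨n₀, fun n hn x => ?_⟩
  have hx : x ∈ Submodule.span R (S : Set M) := hS ▸ Submodule.mem_top
  induction hx using Submodule.span_induction generalizing n with
  | mem x hx => exact hb x n (hn.trans (hn₀ (Finset.mem_coe.2 (Finset.mem_image_of_mem b hx))))
  | zero => exact map_zero _
  | add x y _ _ hx hy => rw [map_add, hx n hn, hy n hn, add_zero]
  | smul r x _ hx =>
    induction r using DirectSum.Decomposition.inductionOn 𝒜 with
    | zero => rw [zero_smul, map_zero]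
    | @homogeneous i r =>
      -- Scalars have degree `i ≥ 0`, so the component in degree `n` comes from degree `n - i ≤ n`,
      -- where `x` already vanishes.
      have h1 := M.proj_smul r.2 (n - i) x
      rw [add_sub_cancel, hx _ (by omega), smul_zero] at h1
      exact h1
    | add r s hr hs => rw [add_smul, map_add, hr, hs, add_zero]

theorem cohomologyPiece_eq_bot_iff {M : GrModule 𝒜} (P : StarInjectiveResolution M)
    (I J : Ideal R) (i : ℕ) (n : ℤ) :
    P.cohomologyPiece I J i n = ⊥ ↔
      ∀ z ∈ P.cocycles I J i, z ∈ (P.E i).piece n → z ∈ P.coboundaries I J i := by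
  rw [Submodule.eq_bot_iff]
  constructor
  · intro h z hz hzn
    exact (Submodule.Quotient.mk_eq_zero ((P.coboundaries I J i).comap
      (P.cocycles I J i).subtype) (x := ⟨z, hz⟩)).1 (h _ ⟨⟨z, hz⟩, hzn, rfl⟩)
  · rintro h _ ⟨⟨z, hz⟩, hzn, rfl⟩
    exact (Submodule.Quotient.mk_eq_zero _).2 (h z hz hzn)

variable [IsLocalRing (baseRing 𝒜)]

theorem pairTorsion_eq_powerTorsion (N : GrModule 𝒜) {xs : List R}
    (hxs : ∀ x ∈ xs, x ∈ 𝒜 1) (hadj : Algebra.adjoin (baseRing 𝒜) {x | x ∈ xs} = ⊤) :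
    pairTorsion (irrelevantIdeal 𝒜) (maxIdealExt 𝒜) N = powerTorsion xs N :=
  Submodule.ext (N.mem_pairTorsion_iff hxs hadj)

/-- The kernel of the differential is the embedded cosyzygy, and torsion of a submodule is tested in
the ambient module. -/
theorem injRes_cocycles (M : GrModule 𝒜) {xs : List R}
    (hxs : ∀ x ∈ xs, x ∈ 𝒜 1) (hadj : Algebra.adjoin (baseRing 𝒜) {x | x ∈ xs} = ⊤) (i : ℕ) :
    M.injRes.cocycles (irrelevantIdeal 𝒜) (maxIdealExt 𝒜) i =
      (powerTorsion xs (M.cosyzygy i)).map (M.cosyzygy i).toHull := by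
  rw [StarInjectiveResolution.cocycles, pairTorsion_eq_powerTorsion _ hxs hadj]
  ext z
  constructor
  · rintro ⟨hz, hdz⟩
    have h1 : (M.cosyzygy (i + 1)).toHull (M.cosyzygyProj i z) = 0 := hdz
    rw [map_eq_zero_iff _ (toHull_injective _)] at h1
    obtain ⟨y, rfl⟩ := (M.cosyzygyProj_eq_zero i z).1 h1
    exact ⟨y, (mem_powerTorsion_of_injective (toHull_injective _)).1 hz, rfl⟩
  · rintro ⟨y, hy, rfl⟩
    refine ⟨(mem_powerTorsion_of_injective (toHull_injective _)).2 hy, ?_⟩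
    change (M.cosyzygy (i + 1)).toHull (M.cosyzygyProj i _) = 0
    rw [(M.cosyzygyProj_eq_zero i _).2 ⟨y, rfl⟩, map_zero]

theorem injRes_coboundaries (M : GrModule 𝒜) {xs : List R}
    (hxs : ∀ x ∈ xs, x ∈ 𝒜 1) (hadj : Algebra.adjoin (baseRing 𝒜) {x | x ∈ xs} = ⊤) (i : ℕ) :
    M.injRes.coboundaries (irrelevantIdeal 𝒜) (maxIdealExt 𝒜) (i + 1) =
      ((powerTorsion xs (M.cosyzygy i).hull).map (M.cosyzygyProj i)).map
        (M.cosyzygy (i + 1)).toHull := by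
  rw [← Submodule.map_comp]
  exact congrArg (Submodule.map (M.injRes.d i)) (pairTorsion_eq_powerTorsion _ hxs hadj)

/-- Comparison of graded local cohomology with Čech cohomology. -/
theorem cocycles_le_iff_cechSMulTop [IsNoetherianRing R] (M : GrModule 𝒜) {xs : List R}
    (hxs : ∀ x ∈ xs, x ∈ 𝒜 1) (hadj : Algebra.adjoin (baseRing 𝒜) {x | x ∈ xs} = ⊤) (K : Ideal R)
    (i : ℕ) :
    M.injRes.cocycles (irrelevantIdeal 𝒜) (maxIdealExt 𝒜) (i + 1) ≤
        K • M.injRes.cocycles (irrelevantIdeal 𝒜) (maxIdealExt 𝒜) (i + 1) ⊔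
          M.injRes.coboundaries (irrelevantIdeal 𝒜) (maxIdealExt 𝒜) (i + 1) ↔
      CechSMulTop xs K (i + 1) M := by
  rw [show i + 1 = 0 + 1 + i by omega, cechSMulTop_cosyzygy M hxs K i 0,
    show 0 + 1 + i = i + 1 by omega, cechSMulTop_one_iff (toHull_injective _)
      (M.exact_toHull_cosyzygyProj i) (M.cosyzygyProj_surjective i) (cechVanish_hull _ hxs _) K,
    injRes_cocycles M hxs hadj, injRes_coboundaries M hxs hadj,
    ← Submodule.map_le_map_iff_of_injective (toHull_injective (M.cosyzygy (i + 1))),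
    Submodule.map_sup, Submodule.map_smul'']
  rfl

/-- Degrees above `c` are positive, so the comparison with `K = ⊥` covers all of them. -/
theorem cechVanish_of_cohomologicalDim [IsNoetherianRing R] (M : GrModule 𝒜) {xs : List R}
    (hxs : ∀ x ∈ xs, x ∈ 𝒜 1) (hadj : Algebra.adjoin (baseRing 𝒜) {x | x ∈ xs} = ⊤) {c : ℕ}
    (hc : M.cohomologicalDim (irrelevantIdeal 𝒜) (maxIdealExt 𝒜) = ((c : ℕ∞) : WithBot ℕ∞))
    {n : ℕ} (hn : c < n) : CechVanish xs n M := by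
  obtain ⟨i, rfl⟩ : ∃ i, n = i + 1 := ⟨n - 1, by omega⟩
  rw [← cechSMulTop_bot, ← cocycles_le_iff_cechSMulTop M hxs hadj, Submodule.bot_smul, bot_sup_eq,
    ← subsingleton_cohomology_iff]
  by_contra hcon
  rw [not_subsingleton_iff_nontrivial] at hcon
  have h1 : (((i + 1 : ℕ) : ℕ∞) : WithBot ℕ∞) ≤
      M.cohomologicalDim (irrelevantIdeal 𝒜) (maxIdealExt 𝒜) := le_sSup ⟨i + 1, hcon, rfl⟩
  rw [hc] at h1
  have h2 : i + 1 ≤ c := by exact_mod_cast h1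
  omega

/-! ### Graded pieces of the cohomology, and tameness. -/

theorem proj_mem_cocycles {M : GrModule 𝒜} (P : StarInjectiveResolution M) {xs : List R}
    (hxs : ∀ x ∈ xs, x ∈ 𝒜 1) (hadj : Algebra.adjoin (baseRing 𝒜) {x | x ∈ xs} = ⊤) {i : ℕ}
    {z : P.E i} (hz : z ∈ P.cocycles (irrelevantIdeal 𝒜) (maxIdealExt 𝒜) i) (n : ℤ) :
    (P.E i).proj n z ∈ P.cocycles (irrelevantIdeal 𝒜) (maxIdealExt 𝒜) i := by
  refine ⟨?_, ?_⟩
  · have h1 := hz.1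
    rw [pairTorsion_eq_powerTorsion _ hxs hadj] at h1 ⊢
    exact (P.E i).proj_mem_powerTorsion hxs h1 n
  · change P.d i _ = 0
    rw [(P.d_homogeneous i).map_proj, LinearMap.mem_ker.1 hz.2, map_zero]

theorem proj_mem_coboundaries {M : GrModule 𝒜} (P : StarInjectiveResolution M) {xs : List R}
    (hxs : ∀ x ∈ xs, x ∈ 𝒜 1) (hadj : Algebra.adjoin (baseRing 𝒜) {x | x ∈ xs} = ⊤) {i : ℕ}
    {z : P.E i} (hz : z ∈ P.coboundaries (irrelevantIdeal 𝒜) (maxIdealExt 𝒜) i) (n : ℤ) :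
    (P.E i).proj n z ∈ P.coboundaries (irrelevantIdeal 𝒜) (maxIdealExt 𝒜) i := by
  match i, z, hz with
  | 0, z, hz =>
    rw [(Submodule.mem_bot R).1 hz, map_zero]
    exact zero_mem _
  | i + 1, _, ⟨w, hw, rfl⟩ =>
    refine ⟨(P.E i).proj n w, ?_, (P.d_homogeneous i).map_proj n w⟩
    rw [SetLike.mem_coe, pairTorsion_eq_powerTorsion _ hxs hadj] at hw ⊢
    exact (P.E i).proj_mem_powerTorsion hxs hw n

/-- If the cohomology module `H` satisfies `H = R₊ H`, then `Hₙ = 0` implies `Hₙ₊₁ = 0`. -/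
theorem cohomologyPiece_succ_eq_bot {M : GrModule 𝒜} (P : StarInjectiveResolution M) {xs : List R}
    (hxs : ∀ x ∈ xs, x ∈ 𝒜 1) (hadj : Algebra.adjoin (baseRing 𝒜) {x | x ∈ xs} = ⊤) {i : ℕ}
    (h : P.cocycles (irrelevantIdeal 𝒜) (maxIdealExt 𝒜) i ≤
      Ideal.span {x | x ∈ xs} • P.cocycles (irrelevantIdeal 𝒜) (maxIdealExt 𝒜) i ⊔
        P.coboundaries (irrelevantIdeal 𝒜) (maxIdealExt 𝒜) i) {n : ℤ}
    (hn : P.cohomologyPiece (irrelevantIdeal 𝒜) (maxIdealExt 𝒜) i n = ⊥) :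
    P.cohomologyPiece (irrelevantIdeal 𝒜) (maxIdealExt 𝒜) i (n + 1) = ⊥ := by
  rw [cohomologyPiece_eq_bot_iff] at hn ⊢
  intro z hz hzn
  rw [← (P.E i).proj_same _ _ hzn]
  obtain ⟨a, ha, b, hb, hab⟩ := Submodule.mem_sup.1 (h hz)
  rw [← hab, map_add]
  refine add_mem ?_ (proj_mem_coboundaries P hxs hadj hb _)
  clear hab hb b
  induction ha using Submodule.smul_induction_on' with
  | add a _ a' _ ha ha' =>
    rw [map_add]
    exact add_mem ha ha'
  | smul r hr a ha =>
    -- Only the generators matter: for `x` of degree one, the part of `x a` in degree `n + 1` is `x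
    -- aₙ`, and `aₙ` is a boundary by `hn`. Ring coefficients are absorbed into the cocycle `a`,
    -- which is why `a` is generalized.
    induction hr using Submodule.span_induction generalizing a with
    | mem x hx =>
      rw [add_comm n 1]
      have h1 := (P.E i).proj_smul (hxs x hx) n a
      rw [Nat.cast_one] at h1
      rw [h1]
      exact Submodule.smul_mem _ x
        (hn _ (proj_mem_cocycles P hxs hadj ha n) ((P.E i).proj_mem n a))
    | zero =>
      rw [zero_smul, map_zero]
      exact zero_mem _
    | add r r' _ _ hr hr' =>
      rw [add_smul, map_add]
      exact add_mem (hr a ha) (hr' a ha)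
    | smul t r _ hr =>
      rw [smul_eq_mul, mul_comm, mul_smul]
      exact hr (t • a) (Submodule.smul_mem _ t ha)


end GrModule

theorem corollary4p4 {R : Type u} [CommRing R] (𝒜 : ℕ → AddSubgroup R) [GradedRing 𝒜]
    [IsLocalRing (baseRing 𝒜)] (hR : IsStandardGraded 𝒜)
    (h : ComponentsEventuallyVanish 𝒜 (maxIdealExt 𝒜) ∨ ComponentsFinite 𝒜 (maxIdealExt 𝒜))
    (M : GrModule 𝒜) (hM : Module.Finite R M)
    (c : ℕ) (hc : M.cohomologicalDim (irrelevantIdeal 𝒜) (maxIdealExt 𝒜) = ((c : ℕ∞) : WithBot ℕ∞)) :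
    IsTame fun n : ℤ => M.localCohomologyPiece (irrelevantIdeal 𝒜) (maxIdealExt 𝒜) c n := by
  have := hR.isNoetherianRing
  obtain ⟨xs, hxs, hadj⟩ := hR.exists_list
  match c with
  | 0 =>
    left
    obtain ⟨n₀, hn₀⟩ := M.exists_proj_eq_zero
    refine ⟨n₀, fun n hn => ?_⟩
    refine (GrModule.cohomologyPiece_eq_bot_iff _ _ _ _ _).2 fun z hz hzn => ?_
    rw [M.injRes_cocycles hxs hadj] at hz
    obtain ⟨y, -, rfl⟩ := hz
    -- A degree-`n` cocycle in cohomological degree zero comes from an element of `M` concentrated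
    -- in degree `n`, hence zero below the bound `n₀`.
    have h1 : M.toHull (M.proj n y) = M.toHull y :=
      (M.toHull_homogeneous.map_proj n y).trans (M.hull.proj_same n _ hzn)
    have h2 : y = 0 := (M.toHull_injective h1).symm.trans (hn₀ n hn y)
    exact h2 ▸ map_zero M.toHull
  | c + 1 =>
    have hsmul := (M.cocycles_le_iff_cechSMulTop hxs hadj (Ideal.span {x | x ∈ xs}) c).2
      (cechSMulTop_top fun n hn => M.cechVanish_of_cohomologicalDim hxs hadj hc hn)
    by_cases hcase : ∃ n₀ : ℤ, ∀ n ≤ n₀,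
        M.localCohomologyPiece (irrelevantIdeal 𝒜) (maxIdealExt 𝒜) (c + 1) n ≠ ⊥
    · exact Or.inr hcase
    · push Not at hcase
      left
      -- The bound `0` is arbitrary: below any `n` lies some `m` with zero piece, and vanishing
      -- propagates upwards from `m` to `n`.
      refine ⟨0, fun n hn => ?_⟩
      clear hn
      obtain ⟨m, hm, hmbot⟩ := hcase n
      induction n, hm using Int.leInduction with
      | base => exact hmbot
      | succ k _ hk => exact GrModule.cohomologyPiece_succ_eq_bot M.injRes hxs hadj hsmul hk
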